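/- Let $H$ be a complex Hilbert space (inner products are linear in the second variable), $0<d<\infty$, and let $X=\{X_k\}_{k\ge1}$ be an admissible sequence: $X_k\in B((\mathbb C^d)^{\otimes k})$, $X_k\ge0$ for all $k$, $X_1$ is invertible and $\limsup_k\|X_k\|^{1/k}<\infty$. Write $X_k=(x_{\alpha,\beta})_{|\alpha|=|\beta|=k}$, indexed by words in $\{1,\dots,d\}$, and for a tuple $T=(T_1,\dots,T_d)$ of bounded operators on a Hilbert space $G$ and a word $\alpha=\alpha(1)\cdots\alpha(k)$ put $T_\alpha=T_{\alpha(1)}\cdots T_{\alpha(k)}$. Let $$\Phi_{T,L}(a)=\sum_{k\ge1}\ \sum_{|\alpha|=|\beta|=k}x_{\alpha,\beta}\,T_\alpha\,a\,L_\beta^*,\qquad \Phi_T=\Phi_{T,T},$$ $$K^R(T,L)(a)=\sum_{k\ge0}\ \sum_{|\alpha|=|\beta|=k}r^2_{\alpha,\beta}\,T_\alpha\,a\,L_\beta^*,\qquad (r^2_{\alpha,\beta})_{|\alpha|=|\beta|=k}=R_k^2=\sum_{l\ge 1}\ \sum_{k_1+\dots+k_l=k,\ k_i\ge1}X_{k_1}\otimes\cdots\otimes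 X_{k_l}\ (k\ge1),\quad R_0^2=1,$$ whenever the series over $k$ are weak-$*$ convergent. Let $D_c(X,H)$ be the set of commuting tuples $T$ in $B(H)^d$ for which the series for $\Phi_T(I)$ converges and $\|\Phi_T(I)\|<1$, and let $\overline D_{cp}(X,G)$ be the set of commuting tuples $T$ in $B(G)^d$ for which the series for $\Phi_T(I)$ converges, $\|\Phi_T(I)\|\le1$ and $\Phi_T^m(I)\searrow0$ strongly. Let $K^R_c$ be the restriction of $K^R$ to $D_c(X,H)\times D_c(X,H)$. A cp kernel on a set $\Sigma$ is a function $F$ from $\Sigma\times\Sigma$ to the normal bounded linear maps on $B(H)$ such that for all $n$ and $V_1,\dots,V_n\in\Sigma$ the map $(a_{ij})\mapsto(F(V_i,V_j)(a_{ij}))$ on $M_n(B(H))$ is completely positive. Given a cp kernel $K$ on $D_c(X,H)$, let $E_K$ be its reproducing kernel $W^*$-correspondence over $B(H)$: the self-dual Hilbert $B(H)$-module, whose elements are functions $f$ on $D_c(X,H)$ with values $f(z)$ in the maps on $B(H)$, generated by the functions $k_{(a,w)}(z)(b)=K(z,w)(ba^*)$, with $\langle k_{(b,z)},f\rangle=f(z)(b)$.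 A function $\phi:D_c(X,H)\to B(H)$ is a multiplier of $E_K$ if $\phi f\in E_K$ for all $f\in E_K$, where $(\phi f)(z)(b)=\phi(z)f(z)(b)$; then $M_\phi f=\phi f$. Let $S_i(T)=T_i$ be the coordinate functions. The $X$-contractivity condition says: every $S_i$ is a multiplier of $E_K$, and the operators $M_{S_i}\otimes I_H$ on $E_K\otimes_{B(H)}H$ are bounded and satisfy $$M_S\otimes I_H:=(M_{S_1}\otimes I_H,\dots,M_{S_d}\otimes I_H)\in\overline D_{cp}(X,\,E_K\otimes_{B(H)}H).\tag{$*$}$$ Theorem. Let $K$ be a cp kernel on $D_c(X,H)$. For all $T,L\in D_c(X,H)$ and $a\in B(H)$ the series for $\Phi_{T,L}(a)$ and $K^R_c(T,L)(a)$ converge, and $K^R_c(T,L)$ is an invertible map on $B(H)$ with bounded linear inverse. Moreover: 1. the condition $(*)$ is equivalent to $(T,L)\mapsto(\mathrm{id}-\Phi_{T,L})\circ K(T,L)$ being a cp kernel; 2. the condition $(*)$ is equivalent to $(T,L)\mapsto K^R_c(T,L)^{-1}\circ K(T,L)$ being a cp kernel. -/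

import Mathlib

open scoped InnerProductSpace ComplexOrder Matrix.Norms.L2Operator CStarAlgebra

noncomputable section

namespace RKCorr

universe u v

/-! ### Weak-* convergent series of operators

For a sequence of operators, convergence of the partial sums in the weak operator topology and in
the weak-* (ultraweak) topology are the same thing, since a weakly convergent sequence is bounded. -/

section Wot

variable {G : Type u} [NormedAddCommGroup G] [InnerProductSpace ℂ G]

/-- The series `∑ f k` of operators converges in the weak operator topology. -/
def WotSummable (f : ℕ → G →L[ℂ] G) : Prop :=
  Summable fun k => ContinuousLinearMapWOT.ofCLM (f k)

/-- The sum of a series of operators in the weak operator topology. -/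
def wotSum (f : ℕ → G →L[ℂ] G) : G →L[ℂ] G :=
  ContinuousLinearMapWOT.toCLM (∑' k, ContinuousLinearMapWOT.ofCLM (f k))

end Wot

/-! ### Weight sequences, the maps `Φ` and the domains -/

/-- A sequence of operators `X_k` on `(ℂ^d)^{⊗ k}`, each written as a matrix indexed by words of
length `k` in `d` letters. The entry `k = 0` is never used. -/
abbrev WeightSeq (d : ℕ) : Type :=
  (k : ℕ) → Matrix (Fin k → Fin d) (Fin k → Fin d) ℂ

/-- Admissible sequences: `X_k ≥ 0` for `k ≥ 1`, `X_1` invertible and `limsup ‖X_k‖^{1/k} < ∞`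
(with the operator norm). -/
structure Admissible {d : ℕ} (X : WeightSeq d) : Prop where
  posSemidef : ∀ k, 1 ≤ k → (X k).PosSemidef
  isUnit : IsUnit (X 1)
  limsup_lt : Filter.limsup (fun k : ℕ => ‖X k‖ₑ ^ (1 / (k : ℝ))) Filter.atTop < ⊤

/-- `R_k ^ 2 = ∑_l ∑_{k_1 + ⋯ + k_l = k} X_{k_1} ⊗ ⋯ ⊗ X_{k_l}` with all `k_i ≥ 1`; the entries of
the tensor product at a pair of words of length `k` are obtained by cutting both words into
consecutive blocks of lengths `k_1, …, k_l`. For `k = 0` there is only the empty composition,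
and `R_0 ^ 2 = 1`. -/
def Rsq {d : ℕ} (X : WeightSeq d) : WeightSeq d := fun k =>
  Matrix.of fun α β => ∑ c : Composition k,
    ∏ i : Fin c.length, X (c.blocksFun i) (α ∘ c.embedding i) (β ∘ c.embedding i)

section Tuples

variable {G : Type u} [NormedAddCommGroup G] [InnerProductSpace ℂ G]

/-- `T_α = T_{α(1)} ⋯ T_{α(k)}` for a word `α` of length `k`. -/
def wordProd {d : ℕ} (T : Fin d → G →L[ℂ] G) {k : ℕ} (α : Fin k → Fin d) : G →L[ℂ] G :=
  (List.ofFn fun i => T (α i)).prod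

variable [CompleteSpace G]

/-- `T^{(k)} (Y_k ⊗ a) L^{(k)*} = ∑_{|α| = |β| = k} y_{α,β} T_α a L_β^*`. -/
def rowTerm {d : ℕ} (Y : WeightSeq d) (T L : Fin d → G →L[ℂ] G) (a : G →L[ℂ] G) (k : ℕ) :
    G →L[ℂ] G :=
  ∑ α : Fin k → Fin d, ∑ β : Fin k → Fin d,
    Y k α β • (wordProd T α * a * star (wordProd L β))

/-- `Φ_{T,L}(a) = ∑_{k ≥ 1} T^{(k)} (X_k ⊗ a) L^{(k)*}`. -/
def Phi {d : ℕ} (X : WeightSeq d) (T L : Fin d → G →L[ℂ] G) (a : G →L[ℂ] G) : G →L[ℂ] G :=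
  wotSum fun k => rowTerm X T L a (k + 1)

/-- `K^R(T,L)(a) = ∑_{k ≥ 0} T^{(k)} (R_k ^ 2 ⊗ a) L^{(k)*}`. -/
def KR {d : ℕ} (X : WeightSeq d) (T L : Fin d → G →L[ℂ] G) (a : G →L[ℂ] G) : G →L[ℂ] G :=
  wotSum fun k => rowTerm (Rsq X) T L a k

variable (G) in
/-- `D_c(X,G)`: commuting tuples for which the series of `Φ_T(I)` converges and
`‖Φ_T(I)‖ < 1`. -/
def Dc {d : ℕ} (X : WeightSeq d) : Set (Fin d → G →L[ℂ] G) :=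
  {T | (∀ i j, T i * T j = T j * T i) ∧
    WotSummable (fun k => rowTerm X T T 1 (k + 1)) ∧ ‖Phi X T T 1‖ < 1}

variable (G) in
/-- The pure commuting tuples in the closed domain: the series of `Φ_T(I)` converges,
`‖Φ_T(I)‖ ≤ 1` and `Φ_T^m(I)` decreases to `0` strongly. -/
def DbarCp {d : ℕ} (X : WeightSeq d) : Set (Fin d → G →L[ℂ] G) :=
  {T | (∀ i j, T i * T j = T j * T i) ∧
    WotSummable (fun k => rowTerm X T T 1 (k + 1)) ∧ ‖Phi X T T 1‖ ≤ 1 ∧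
    Antitone (fun m : ℕ => (Phi X T T)^[m] 1) ∧
    ∀ h : G, Filter.Tendsto (fun m : ℕ => ((Phi X T T)^[m] 1) h) Filter.atTop (nhds 0)}

end Tuples

/-! ### Map-valued completely positive kernels -/

section Kernels

variable {H : Type u} [NormedAddCommGroup H] [InnerProductSpace ℂ H]

/-- The functionals in the predual of `B(H)`: `a ↦ ∑ ⟨x_n, a y_n⟩` with square summable
sequences `x`, `y`. -/
def IsNormalFunctional (ω : (H →L[ℂ] H) → ℂ) : Prop :=
  ∃ x y : ℕ → H, Summable (fun n => ‖x n‖ ^ 2) ∧ Summable (fun n => ‖y n‖ ^ 2) ∧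
    ∀ a, ω a = ∑' n, ⟪x n, a (y n)⟫_ℂ

/-- `φ ∈ B_*(B(H), B(H))`: a bounded linear map which is ultraweakly continuous, i.e. which pulls
back the predual into the predual. -/
def IsNormalMap (φ : (H →L[ℂ] H) → (H →L[ℂ] H)) : Prop :=
  (∃ φ' : (H →L[ℂ] H) →L[ℂ] (H →L[ℂ] H), ⇑φ' = φ) ∧
    ∀ ω : (H →L[ℂ] H) → ℂ, IsNormalFunctional ω → IsNormalFunctional (ω ∘ φ)

variable [CompleteSpace H]

/-- `F : S × S → B_*(B(H), B(H))` is a completely positive kernel: its values are normal maps and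
for all `V_1, …, V_n` in `S` the map `(a_{ij}) ↦ (F(V_i,V_j)(a_{ij}))` on `M_n(B(H))` is completely
positive. -/
structure IsCPKernel {S : Type v} (F : S → S → (H →L[ℂ] H) → (H →L[ℂ] H)) : Prop where
  normal : ∀ z w, IsNormalMap (F z w)
  cp : ∀ (n : ℕ) (V : Fin n → S),
    ∃ Ψ : CStarMatrix (Fin n) (Fin n) (H →L[ℂ] H) →CP CStarMatrix (Fin n) (Fin n) (H →L[ℂ] H),
      ∀ M i j, Ψ M i j = F (V i) (V j) (M i j)

variable (H) in
/-- A map-valued completely positive kernel on a set `S`, with values in the normal maps on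
`B(H)`. -/
structure CPKernel (S : Type v) where
  /-- the underlying function -/
  toFun : S → S → (H →L[ℂ] H) → (H →L[ℂ] H)
  isCPKernel : IsCPKernel toFun

instance {S : Type v} : CoeFun (CPKernel H S)
    (fun _ => S → S → (H →L[ℂ] H) → (H →L[ℂ] H)) := ⟨CPKernel.toFun⟩

/-- A positive matrix over `B(H)` is self-adjoint and gives a positive quadratic form. -/
theorem cstarMatrix_nonneg {n : ℕ} {M : CStarMatrix (Fin n) (Fin n) (H →L[ℂ] H)} (hM : 0 ≤ M) :
    (∀ i j, star (M i j) = M j i) ∧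
      ∀ h : Fin n → H, 0 ≤ RCLike.re (∑ i, ∑ j, ⟪M i j (h j), h i⟫_ℂ) := by
  rw [StarOrderedRing.nonneg_iff] at hM
  induction hM using AddSubmonoid.closure_induction with
  | zero => simp
  | add M N _ _ h₁ h₂ =>
    refine ⟨fun i j => by simp [h₁.1 i j, h₂.1 i j], fun h => ?_⟩
    have := add_nonneg (h₁.2 h) (h₂.2 h)
    simpa [inner_add_left, Finset.sum_add_distrib] using this
  | mem M hM =>
    obtain ⟨N, rfl⟩ := hM
    refine ⟨fun i j => by simp [CStarMatrix.mul_apply, CStarMatrix.star_apply, star_sum],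
      fun h => ?_⟩
    have key : ∑ i, ∑ j, ⟪(star N * N) i j (h j), h i⟫_ℂ =
        ∑ k, ⟪∑ j, N k j (h j), ∑ i, N k i (h i)⟫_ℂ := by
      simp only [CStarMatrix.mul_apply, CStarMatrix.star_apply, sum_inner, inner_sum,
        sum_apply, mul_apply_eq_comp,
        ContinuousLinearMap.star_eq_adjoint, ContinuousLinearMap.adjoint_inner_left]
      rw [Finset.sum_comm' (t' := Finset.univ) (s' := fun _ => Finset.univ) (by simp)]
      conv_lhs => enter [2, j]; rw [Finset.sum_comm]
      rw [Finset.sum_comm]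
      exact Finset.sum_congr rfl fun y _ => Finset.sum_comm
    show 0 ≤ RCLike.re (∑ i, ∑ j, ⟪(star N * N) i j (h j), h i⟫_ℂ)
    rw [key, map_sum]
    exact Finset.sum_nonneg fun k _ => inner_self_nonneg

variable {S : Type v}

theorem IsCPKernel.matrix_nonneg {F : S → S → (H →L[ℂ] H) → (H →L[ℂ] H)} (hF : IsCPKernel F)
    {n : ℕ} (p : Fin n → S × (H →L[ℂ] H)) :
    0 ≤ (CStarMatrix.ofMatrix (Matrix.of fun i j =>
      F (p i).1 (p j).1 ((p i).2 * star (p j).2)) :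
        CStarMatrix (Fin n) (Fin n) (H →L[ℂ] H)) := by
  obtain ⟨Ψ, hΨ⟩ := hF.cp n fun i => (p i).1
  rcases n with _ | n
  · exact le_of_eq (CStarMatrix.ext fun i => i.elim0)
  let C : CStarMatrix (Fin (n + 1)) (Fin (n + 1)) (H →L[ℂ] H) :=
    CStarMatrix.ofMatrix (Matrix.of fun i j => if j = 0 then (p i).2 else 0)
  have h0 : 0 ≤ Ψ (C * star C) := map_nonneg Ψ (mul_star_self_nonneg C)
  convert h0 using 1
  refine CStarMatrix.ext fun i j => ?_
  rw [hΨ]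
  simp [C, CStarMatrix.mul_apply, CStarMatrix.star_apply]

theorem posSemidef_of_sum_nonneg {Y : Type*} {Q : Matrix Y Y (H →L[ℂ] H)} (h₁ : Q.IsHermitian)
    (h₂ : ∀ vv : Y →₀ H, 0 ≤ RCLike.re (vv.sum fun x w => vv.sum fun x' w' => ⟪Q x' x w, w'⟫_ℂ)) :
    Q.PosSemidef := by
  have h := (RKHS.posSemidef_tfae (K := Q)).out 0 2
  exact h.mpr ⟨h₁, h₂⟩

/-! ### The reproducing kernel correspondence -/

/-- The `B(H)`-valued kernel `((z,b),(w,a)) ↦ K(z,w)(b a^*)` on `S × B(H)`; its values are the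
inner products `⟨k_{(b,z)}, k_{(a,w)}⟩` of the kernel functions. -/
def CPKernel.opKernel (K : CPKernel H S) :
    Matrix (S × (H →L[ℂ] H)) (S × (H →L[ℂ] H)) (H →L[ℂ] H) :=
  Matrix.of fun p q => K p.1 q.1 (p.2 * star q.2)

instance (K : CPKernel H S) : Fact K.opKernel.PosSemidef where
  out := by
    refine posSemidef_of_sum_nonneg (Matrix.IsHermitian.ext fun p q => ?_) fun vv => ?_
    · exact (cstarMatrix_nonneg (K.isCPKernel.matrix_nonneg ![q, p])).1 0 1
    · let e := vv.support.equivFin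
      have h := (cstarMatrix_nonneg (K.isCPKernel.matrix_nonneg fun i => (e.symm i).1)).2
        fun i => vv (e.symm i)
      have e2 (g : S × (H →L[ℂ] H) → ℂ) : ∑ x ∈ vv.support, g x = ∑ i, g (e.symm i) := by
        rw [← Finset.sum_coe_sort, ← e.symm.sum_comp]
      have h' : 0 ≤ RCLike.re (∑ i, ∑ j,
        ⟪K.opKernel (e.symm i) (e.symm j) (vv (e.symm j)), vv (e.symm i)⟫_ℂ) := h
      rw [Finset.sum_comm] at h'
      simpa only [Finsupp.sum, e2] using h'

/-- The Hilbert space generated by vectors `k_{(a,w)} ⊗ h` (`a ∈ B(H)`, `w ∈ S`, `h ∈ H`) with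
`⟨k_{(b,z)} ⊗ h, k_{(a,w)} ⊗ g⟩ = ⟨h, K(z,w)(b a^*) g⟩`: the completion of `E₀ ⊗ H`, where `E₀` is
the pre-Hilbert `B(H)`-module of the finite sums `∑ k_{(a_i,w_i)} · c_i`. -/
abbrev CPKernel.Space (K : CPKernel H S) : Type (max u v) := RKHS.OfKernel K.opKernel

/-- The reproducing kernel `W^*`-correspondence `E_K`, that is, the self-dual completion of the
pre-Hilbert `B(H)`-module `E₀` of the finite sums `∑ k_{(a_i,w_i)} · c_i`. The self-dual completion
of a module over `B(H)` consists of all bounded operators from `H` to (the completion of) `E₀ ⊗ H`,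
a vector `x` of `E₀` being the operator `h ↦ x ⊗ h`. The inner product is `f^* g` (see `inn`),
the right action of `c ∈ B(H)` is `f · c = f ∘ c`, and the elements are functions `S → B(H) → B(H)`
by `eval`. That this is the right module is checked by `inn_ker_left`, `eval_ker`, `eval_injective`
and `selfDual`. -/
abbrev CPKernel.Corr (K : CPKernel H S) : Type (max u v) := H →L[ℂ] K.Space

namespace CPKernel

variable {K : CPKernel H S}

/-- The `B(H)`-valued inner product `⟨f, g⟩` of `E_K`, linear in the second variable. -/
def inn (f g : K.Corr) : H →L[ℂ] H := ContinuousLinearMap.adjoint f ∘L g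

/-- The kernel function `k_{(a,w)} ∈ E_K`. -/
def ker (K : CPKernel H S) (a : H →L[ℂ] H) (w : S) : K.Corr := RKHS.kerFun K.Space (w, a)

/-- The elements `f` of `E_K` as functions on `S` whose values `f(z)` are maps on `B(H)`. The vector
`f h` of `K.Space` is itself an `H`-valued function on `S × B(H)`, and `f(z)(b) h = (f h)(z, b)`. -/
def eval (f : K.Corr) (z : S) (b : H →L[ℂ] H) : H →L[ℂ] H :=
  (ContinuousLinearMap.proj (z, b) ∘L RKHS.coeCLM ℂ) ∘L f

/-- The reproducing property `⟨k_{(b,z)}, f⟩ = f(z)(b)`. -/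
theorem inn_ker_left (b : H →L[ℂ] H) (z : S) (f : K.Corr) : inn (K.ker b z) f = eval f z b := by
  ext h
  simp [inn, ker, eval]

/-- `k_{(a,w)}(z)(b) = K(z,w)(b a^*)`. -/
theorem eval_ker (a b : H →L[ℂ] H) (w z : S) : eval (K.ker a w) z b = K z w (b * star a) := by
  rw [← inn_ker_left]
  have := RKHS.kernel_apply (H := K.Space) (z, b) (w, a)
  rw [RKHS.OfKernel.kernel_ofKernel] at this
  exact this.symm

/-- An element of `E_K` is determined by its function; equivalently, only `0` is orthogonal to
all kernel functions, so that these generate `E_K` as a `W^*`-module. -/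
theorem eval_injective : Function.Injective (eval : K.Corr → S → (H →L[ℂ] H) → (H →L[ℂ] H)) := by
  intro f g hfg
  refine ContinuousLinearMap.ext fun h => RKHS.ext fun p => ?_
  exact congrArg (fun F : H →L[ℂ] H => F h) (congrFun (congrFun hfg p.1) p.2)

/-- `E_K` is self-dual: every bounded `B(H)`-linear map `E_K → B(H)` is an inner product with an
element of `E_K`. -/
theorem selfDual (Ψ : K.Corr →L[ℂ] (H →L[ℂ] H))
    (hΨ : ∀ (f : K.Corr) (c : H →L[ℂ] H), Ψ (f ∘L c) = Ψ f ∘L c) :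
    ∃ g : K.Corr, ∀ f, Ψ f = inn g f := by
  by_cases hH : Subsingleton H
  · exact ⟨0, fun f => Subsingleton.elim _ _⟩
  rw [not_subsingleton_iff_nontrivial] at hH
  obtain ⟨e, he⟩ := exists_norm_eq H (zero_le_one (α := ℝ))
  let ψ : K.Space →L[ℂ] H :=
    ContinuousLinearMap.apply ℂ H e ∘L Ψ ∘L
      ContinuousLinearMap.smulRightL ℂ H K.Space (innerSL ℂ e)
  refine ⟨ContinuousLinearMap.adjoint ψ, fun f => ?_⟩
  ext h
  have h1 : ContinuousLinearMap.smulRightL ℂ H K.Space (innerSL ℂ e) (f h) =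
      f ∘L (innerSL ℂ e).smulRight h := by
    ext x
    simp
  have h2 : ψ (f h) = Ψ f h := by
    simp only [ψ, ContinuousLinearMap.comp_apply, h1, hΨ]
    simp [he]
  simp [inn, h2]

/-- `φ : S → B(H)` is a multiplier of `E_K` if for each `f ∈ E_K` the function
`(φ f)(z)(b) = φ(z) f(z)(b)` is in `E_K`. -/
def IsMultiplier (K : CPKernel H S) (φ : S → H →L[ℂ] H) : Prop :=
  ∀ f : K.Corr, ∃ g : K.Corr, ∀ z b, eval g z b = φ z * eval f z b

/-- The multiplication operator `M_φ : E_K → E_K`, `f ↦ φ f`, of a multiplier `φ`. -/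
def mulOp {φ : S → H →L[ℂ] H} (hφ : K.IsMultiplier φ) (f : K.Corr) : K.Corr := (hφ f).choose

/-! ### The interior tensor product with `H` -/

/-- The Gram kernel `(f, g) ↦ ⟨f, g⟩` on `E_K`. -/
def gram (K : CPKernel H S) : Matrix K.Corr K.Corr (H →L[ℂ] H) :=
  Matrix.of fun f g => inn f g

instance (K : CPKernel H S) : Fact K.gram.PosSemidef where
  out := by
    refine posSemidef_of_sum_nonneg ?_ fun vv => ?_
    · ext f g : 2
      simp [gram, inn, ContinuousLinearMap.star_eq_adjoint, ContinuousLinearMap.adjoint_comp]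
    · have key : (vv.sum fun f h => vv.sum fun g h' => ⟪K.gram g f h, h'⟫_ℂ) =
          ⟪vv.sum fun f h => f h, vv.sum fun f h => f h⟫_ℂ := by
        simp only [Finsupp.sum, sum_inner, inner_sum, gram, inn, Matrix.of_apply,
          ContinuousLinearMap.comp_apply, ContinuousLinearMap.adjoint_inner_left]
        exact Finset.sum_comm
      rw [key]
      exact inner_self_nonneg

/-- The Hilbert space `E_K ⊗_{B(H)} H`: the completion of the span of the vectors `f ⊗ h` with
`⟨f ⊗ h, g ⊗ h'⟩ = ⟨h, ⟨f, g⟩ h'⟩` (realized as a space of functions on `E_K`). -/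
abbrev Tensor (K : CPKernel H S) : Type (max u v) := RKHS.OfKernel K.gram

/-- The vector `f ⊗ h` of `E_K ⊗_{B(H)} H`. -/
def tmul (f : K.Corr) (h : H) : K.Tensor := RKHS.kerFun K.Tensor f h

theorem inner_tmul (f g : K.Corr) (h h' : H) : ⟪tmul f h, tmul g h'⟫_ℂ = ⟪h, inn f g h'⟫_ℂ := by
  rw [tmul, RKHS.kerFun_inner, tmul, RKHS.kerFun_apply, RKHS.OfKernel.kernel_ofKernel]
  rfl

end CPKernel

end Kernels

/-- The coordinate function `S_i : D_c(X,H) → B(H)`, `S_i(T) = T_i`. -/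
def coord {H : Type u} [NormedAddCommGroup H] [InnerProductSpace ℂ H] [CompleteSpace H] {d : ℕ}
    (X : WeightSeq d) (i : Fin d) (T : Dc H X) : H →L[ℂ] H := T.1 i

/-- The `X`-contractivity condition: the coordinate functions `S_i` are multipliers of `E_K`, and
the tuple `M_S ⊗ I_H = (M_{S_i} ⊗ I_H)_i` of bounded operators on `E_K ⊗_{B(H)} H` belongs to the
set of pure commuting tuples in the closed domain. As the vectors `f ⊗ h` are total, the operators
`M i = M_{S_i} ⊗ I_H` are determined by `M i (f ⊗ h) = (S_i f) ⊗ h`. -/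
def XContractive {H : Type u} [NormedAddCommGroup H] [InnerProductSpace ℂ H] [CompleteSpace H]
    {d : ℕ} (X : WeightSeq d) (K : CPKernel H (Dc H X)) : Prop :=
  ∃ hS : ∀ i, K.IsMultiplier (coord X i),
    ∃ M : Fin d → K.Tensor →L[ℂ] K.Tensor,
      (∀ i (f : K.Corr) (h : H), M i (CPKernel.tmul f h) =
        CPKernel.tmul (CPKernel.mulOp (hS i) f) h) ∧
      M ∈ DbarCp K.Tensor X

end RKCorr

end

/-! The kernel factors through a Hilbert space: K(z,w)(ba*) = E_p* E_q with p = (z,b), q = (w,a),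
where the ranges of the E_p are total. On such a model the candidates for M_{S_i} are the operators
M_i with M_i* E_p = E_p z_i*. Compression turns Φ_M into Φ_{z,w}: E_p* Φ_M(a) E_q = Φ_{z,w}(E_p* a
E_q) (`Intertwines.compress_phi`). With a = I, the quadratic form of 1 - Φ_M(I) at ∑ E_p h_p is the
quadratic form of the kernel (id - Φ) ∘ K. Hence contractivity of M gives complete positivity
(`Intertwines.isCPKernel`).

Conversely, complete positivity bounds all partial sums of the series by ‖∑ E_p h_p‖². Its first
term, together with the invertibility of X_1, makes E_p h ↦ E_p z_i* h bounded, so M exists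
(`exists_intertwines`); the whole sum gives Φ_M(I) ≤ I. Purity is automatic: E_p* Φ_M^m(I) E_p =
Φ_z^m(K(z,z)(bb*)) tends to 0 geometrically, since ‖Φ_z‖ < 1 on the open domain
(`Intertwines.mem_dbarCp`).

Two models are used: `K.Space`, where E_K = B(H, `K.Space`) makes the S_i multipliers, and E_K ⊗ H,
where M is M_S ⊗ I. Finally K^R = ∑ Φ^l inverts id - Φ (`kr_sub_phi_kr`, `kr_inverse`), so both
criteria concern the same kernel.

The mixed maps Φ_{T,L} are controlled by the diagonal ones through `Dominated`, a Cauchy–Schwarz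
inequality stable under sums, weak limits and the maps themselves. -/

noncomputable section

namespace RKCorr

universe u v

/-! ### Weak operator sums -/

section WeakSums

variable {G : Type u} [NormedAddCommGroup G] [InnerProductSpace ℂ G]

/-- `∑ f i = A` unconditionally in the weak operator topology. -/
def WotHasSum {ι : Type*} (f : ι → G →L[ℂ] G) (A : G →L[ℂ] G) : Prop :=
  ∀ g h : G, HasSum (fun i => ⟪g, f i h⟫_ℂ) ⟪g, A h⟫_ℂ

variable [CompleteSpace G]

theorem wotHasSum_iff {ι : Type*} {f : ι → G →L[ℂ] G} {A : G →L[ℂ] G} :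
    WotHasSum f A ↔
      HasSum (fun i => ContinuousLinearMapWOT.ofCLM (f i)) (ContinuousLinearMapWOT.ofCLM A) := by
  have key (s : Finset ι) (g h : G) :
      ⟪g, (∑ i ∈ s, ContinuousLinearMapWOT.ofCLM (f i)) h⟫_ℂ = ∑ i ∈ s, ⟪g, f i h⟫_ℂ := by
    induction s using Finset.cons_induction with
    | empty => simp
    | cons a s ha ih => simp [ih]
  simp only [HasSum, ContinuousLinearMapWOT.tendsto_iff_forall_inner_apply_tendsto, key,
    WotHasSum]
  exact forall_comm

theorem WotSummable.hasSum {f : ℕ → G →L[ℂ] G} (hf : WotSummable f) : WotHasSum f (wotSum f) :=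
  wotHasSum_iff.2 (Summable.hasSum hf)

theorem WotHasSum.summable {f : ℕ → G →L[ℂ] G} {A : G →L[ℂ] G} (hf : WotHasSum f A) :
    WotSummable f :=
  (wotHasSum_iff.1 hf).summable

theorem WotHasSum.wotSum_eq {f : ℕ → G →L[ℂ] G} {A : G →L[ℂ] G} (hf : WotHasSum f A) :
    wotSum f = A := by
  rw [wotSum, (wotHasSum_iff.1 hf).tsum_eq]

omit [CompleteSpace G] in
theorem WotHasSum.re_hasSum {ι : Type*} {f : ι → G →L[ℂ] G} {A : G →L[ℂ] G} (hf : WotHasSum f A)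
    (g h : G) : HasSum (fun i => RCLike.re ⟪g, f i h⟫_ℂ) (RCLike.re ⟪g, A h⟫_ℂ) :=
  Complex.hasSum_re (hf g h)

/-- A weakly summable family of operators whose sum is a bounded sesquilinear form has an operator
as its weak sum. -/
theorem exists_wotHasSum {ι : Type*} {f : ι → G →L[ℂ] G}
    (hs : ∀ g h : G, Summable fun i => ⟪g, f i h⟫_ℂ) (C : ℝ)
    (hC : ∀ g h : G, ‖∑' i, ⟪g, f i h⟫_ℂ‖ ≤ C * ‖g‖ * ‖h‖) : ∃ A, WotHasSum f A := by
  let B₀ : G →ₗ⋆[ℂ] G →ₗ[ℂ] ℂ :=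
    LinearMap.mk₂'ₛₗ (starRingEnd ℂ) (RingHom.id ℂ) (fun g h => ∑' i, ⟪g, f i h⟫_ℂ)
      (fun g g' h => by simp only [inner_add_left]; exact (hs g h).tsum_add (hs g' h))
      (fun c g h => by simp only [inner_smul_left, tsum_mul_left, smul_eq_mul])
      (fun g h h' => by
        simp only [map_add, inner_add_right]; exact (hs g h).tsum_add (hs g h'))
      (fun c g h => by
        simp only [map_smul, inner_smul_right, tsum_mul_left, smul_eq_mul, RingHom.id_apply])
  let B : G →L⋆[ℂ] G →L[ℂ] ℂ := B₀.mkContinuous₂ C hC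
  -- The operator representing a bounded form stands in the left slot of the inner product; its
  -- adjoint moves it to the right slot.
  refine ⟨ContinuousLinearMap.adjoint (InnerProductSpace.continuousLinearMapOfBilin B),
    fun g h => ?_⟩
  rw [ContinuousLinearMap.adjoint_inner_right,
    InnerProductSpace.continuousLinearMapOfBilin_apply]
  exact (hs g h).hasSum

end WeakSums

/-! ### Dominated operators -/

section Dominated

variable {G : Type u} [NormedAddCommGroup G] [InnerProductSpace ℂ G]

/-- `|⟨g, f h⟩|² ≤ ⟨g, p g⟩ ⟨h, q h⟩` with `p, q ≥ 0`; this says that the operator matrix with rows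
`(p, f)` and `(f^*, q)` is positive. -/
structure Dominated (f p q : G →L[ℂ] G) : Prop where
  left : p.IsPositive
  right : q.IsPositive
  le : ∀ g h : G, ‖⟪g, f h⟫_ℂ‖ ≤ √(RCLike.re ⟪g, p g⟫_ℂ) * √(RCLike.re ⟪h, q h⟫_ℂ)

theorem inner_eq_ofReal_re {p : G →L[ℂ] G} (hp : p.IsPositive) (g : G) :
    ⟪g, p g⟫_ℂ = (RCLike.re ⟪g, p g⟫_ℂ : ℝ) := by
  have := hp.inner_nonneg_right g
  rw [Complex.nonneg_iff] at this
  exact Complex.ext rfl (by simpa using this.2.symm)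

theorem re_inner_le_norm_mul (p : G →L[ℂ] G) (g : G) :
    RCLike.re ⟪g, p g⟫_ℂ ≤ ‖p‖ * ‖g‖ ^ 2 := by
  calc RCLike.re ⟪g, p g⟫_ℂ ≤ ‖⟪g, p g⟫_ℂ‖ := RCLike.re_le_norm _
    _ ≤ ‖g‖ * ‖p g‖ := norm_inner_le_norm _ _
    _ ≤ ‖g‖ * (‖p‖ * ‖g‖) := by gcongr; exact p.le_opNorm g
    _ = _ := by ring

theorem Dominated.norm_le_of_le {f p q : G →L[ℂ] G} (h : Dominated f p q) {C D : ℝ}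
    (hp : ∀ g : G, RCLike.re ⟪g, p g⟫_ℂ ≤ C * ‖g‖ ^ 2)
    (hq : ∀ g : G, RCLike.re ⟪g, q g⟫_ℂ ≤ D * ‖g‖ ^ 2) : ‖f‖ ≤ √C * √D := by
  refine f.opNorm_le_bound (by positivity) fun x => ?_
  -- Domination is tested on the pair (f x, x), after which a factor ‖f x‖ cancels.
  by_cases hx : ‖f x‖ = 0
  · rw [hx]; positivity
  have h2 : ‖f x‖ * ‖f x‖ ≤ (√C * ‖f x‖) * (√D * ‖x‖) := by
    calc ‖f x‖ * ‖f x‖ = ‖⟪f x, f x⟫_ℂ‖ := by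
          rw [inner_self_eq_norm_sq_to_K, norm_pow, RCLike.norm_ofReal, abs_norm, sq]
      _ ≤ _ := h.le (f x) x
      _ ≤ √(C * ‖f x‖ ^ 2) * √(D * ‖x‖ ^ 2) := by
        gcongr
        · exact hp _
        · exact hq _
      _ = _ := by
        rw [Real.sqrt_mul' _ (by positivity), Real.sqrt_mul' _ (by positivity),
          Real.sqrt_sq (norm_nonneg _), Real.sqrt_sq (norm_nonneg _)]
  refine le_of_mul_le_mul_right ?_ (lt_of_le_of_ne (norm_nonneg _) (Ne.symm hx))
  calc _ ≤ _ := h2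
    _ = _ := by ring

theorem Dominated.norm_le {f p q : G →L[ℂ] G} (h : Dominated f p q) : ‖f‖ ≤ √‖p‖ * √‖q‖ :=
  h.norm_le_of_le (re_inner_le_norm_mul p) (re_inner_le_norm_mul q)

/-- Cauchy–Schwarz in the plane for the vectors (√a, √c) and (√b, √d). -/
theorem sqrt_mul_sqrt_add_le {a b c d : ℝ} (ha : 0 ≤ a) (hb : 0 ≤ b) (hc : 0 ≤ c) (hd : 0 ≤ d) :
    √a * √b + √c * √d ≤ √(a + c) * √(b + d) := by
  have := Real.sum_sqrt_mul_sqrt_le (f := ![a, c]) (g := ![b, d]) Finset.univ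
    (by intro i; fin_cases i <;> simpa) (by intro i; fin_cases i <;> simpa)
  simpa [Fin.sum_univ_two] using this

theorem dominated_zero {p q : G →L[ℂ] G} (hp : p.IsPositive) (hq : q.IsPositive) :
    Dominated 0 p q :=
  ⟨hp, hq, fun g h => by simp; positivity⟩

theorem Dominated.add {f p q f' p' q' : G →L[ℂ] G} (h : Dominated f p q)
    (h' : Dominated f' p' q') : Dominated (f + f') (p + p') (q + q') := by
  refine ⟨h.left.add h'.left, h.right.add h'.right, fun x y => ?_⟩
  simp only [add_apply, inner_add_right, map_add]
  refine (norm_add_le _ _).trans ((add_le_add (h.le x y) (h'.le x y)).trans ?_)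
  exact sqrt_mul_sqrt_add_le (h.left.re_inner_nonneg_right x) (h.right.re_inner_nonneg_right y)
    (h'.left.re_inner_nonneg_right x) (h'.right.re_inner_nonneg_right y)

theorem Dominated.sum {ι : Type*} {f p q : ι → G →L[ℂ] G} (s : Finset ι)
    (h : ∀ i ∈ s, Dominated (f i) (p i) (q i)) :
    Dominated (∑ i ∈ s, f i) (∑ i ∈ s, p i) (∑ i ∈ s, q i) := by
  induction s using Finset.cons_induction with
  | empty =>
    simpa using
      dominated_zero ContinuousLinearMap.isPositive_zero ContinuousLinearMap.isPositive_zero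
  | cons a s ha ih =>
    simp only [Finset.sum_cons]
    exact (h a (by simp)).add (ih fun i hi => h i (by simp [hi]))

theorem IsPositive.exists_inner_eq [CompleteSpace G] {p : G →L[ℂ] G} (hp : p.IsPositive) :
    ∃ s : G →L[ℂ] G, ∀ x y, ⟪x, p y⟫_ℂ = ⟪s x, s y⟫_ℂ := by
  obtain ⟨s, hs⟩ := CStarAlgebra.nonneg_iff_eq_star_mul_self.1
    ((ContinuousLinearMap.nonneg_iff_isPositive p).2 hp)
  refine ⟨s, fun x y => ?_⟩
  rw [hs]
  simp [ContinuousLinearMap.star_eq_adjoint, ContinuousLinearMap.adjoint_inner_right]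

theorem IsPositive.dominated [CompleteSpace G] {p : G →L[ℂ] G} (hp : p.IsPositive) :
    Dominated p p p := by
  refine ⟨hp, hp, fun g h => ?_⟩
  obtain ⟨s, key⟩ := IsPositive.exists_inner_eq hp
  simp only [key, inner_self_eq_norm_sq, Real.sqrt_sq (norm_nonneg _)]
  exact norm_inner_le_norm _ _

/-- The entry point for arbitrary operators: estimates at I, which is all that membership in the
domain supplies, pass to every a through this domination. -/
theorem dominated_norm (a : G →L[ℂ] G) :
    Dominated a ((‖a‖ : ℂ) • 1) ((‖a‖ : ℂ) • 1) := by
  have hp : ((‖a‖ : ℂ) • (1 : G →L[ℂ] G)).IsPositive :=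
    ContinuousLinearMap.isPositive_one.smul_of_nonneg (by simp)
  refine ⟨hp, hp, fun g h => ?_⟩
  have key (x : G) : RCLike.re ⟪x, ((‖a‖ : ℂ) • (1 : G →L[ℂ] G)) x⟫_ℂ = ‖a‖ * ‖x‖ ^ 2 := by
    simp only [smul_apply, one_apply_eq_self, inner_smul_right, inner_self_eq_norm_sq_to_K]
    simp [← Complex.ofReal_pow]
  rw [key, key, Real.sqrt_mul (norm_nonneg _), Real.sqrt_mul (norm_nonneg _),
    Real.sqrt_sq (norm_nonneg _), Real.sqrt_sq (norm_nonneg _)]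
  calc ‖⟪g, a h⟫_ℂ‖ ≤ ‖g‖ * ‖a h‖ := norm_inner_le_norm _ _
    _ ≤ ‖g‖ * (‖a‖ * ‖h‖) := by gcongr; exact a.le_opNorm h
    _ = (√‖a‖ * √‖a‖) * (‖g‖ * ‖h‖) := by rw [Real.mul_self_sqrt (norm_nonneg _)]; ring
    _ = _ := by ring

variable [CompleteSpace G]

omit [CompleteSpace G] in
theorem isPositive_of_inner_nonneg {P : G →L[ℂ] G} (h : ∀ g, 0 ≤ ⟪g, P g⟫_ℂ) : P.IsPositive := by
  rw [ContinuousLinearMap.isPositive_iff_complex]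
  intro g
  have h2 : 0 ≤ ⟪P g, g⟫_ℂ := by
    rw [← inner_conj_symm]
    exact star_nonneg_iff.2 (h g)
  rw [Complex.nonneg_iff] at h2
  exact ⟨Complex.ext (by simp) (by simpa using h2.2), by simpa using h2.1⟩

omit [CompleteSpace G] in
theorem WotHasSum.isPositive {ι : Type*} {p : ι → G →L[ℂ] G} {P : G →L[ℂ] G}
    (h : WotHasSum p P) (hp : ∀ i, (p i).IsPositive) : P.IsPositive :=
  isPositive_of_inner_nonneg fun g => (h g g).nonneg fun i => (hp i).inner_nonneg_right g

/-- A family of operators dominated by two families with bounded partial sums is weakly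
summable. -/
theorem exists_wotHasSum_of_dominated_of_le {ι : Type*} {f p q : ι → G →L[ℂ] G}
    (hd : ∀ i, Dominated (f i) (p i) (q i)) {C D : ℝ}
    (hp : ∀ (s : Finset ι) (g : G), ∑ i ∈ s, RCLike.re ⟪g, p i g⟫_ℂ ≤ C * ‖g‖ ^ 2)
    (hq : ∀ (s : Finset ι) (g : G), ∑ i ∈ s, RCLike.re ⟪g, q i g⟫_ℂ ≤ D * ‖g‖ ^ 2) :
    ∃ F, WotHasSum f F := by
  -- Cauchy–Schwarz over the index bounds the absolute partial sums, giving both summability and a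
  -- bounded limiting form.
  have bound (s : Finset ι) (g h : G) :
      ∑ i ∈ s, ‖⟪g, f i h⟫_ℂ‖ ≤ √C * √D * ‖g‖ * ‖h‖ := by
    calc _ ≤ ∑ i ∈ s, √(RCLike.re ⟪g, p i g⟫_ℂ) * √(RCLike.re ⟪h, q i h⟫_ℂ) :=
          Finset.sum_le_sum fun i _ => (hd i).le g h
      _ ≤ √(∑ i ∈ s, RCLike.re ⟪g, p i g⟫_ℂ) * √(∑ i ∈ s, RCLike.re ⟪h, q i h⟫_ℂ) :=
          Real.sum_sqrt_mul_sqrt_le s (fun i => (hd i).left.re_inner_nonneg_right g)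
            (fun i => (hd i).right.re_inner_nonneg_right h)
      _ ≤ √(C * ‖g‖ ^ 2) * √(D * ‖h‖ ^ 2) := by
          gcongr
          · exact hp s g
          · exact hq s h
      _ = _ := by
          rw [Real.sqrt_mul' _ (by positivity), Real.sqrt_mul' _ (by positivity),
            Real.sqrt_sq (norm_nonneg _), Real.sqrt_sq (norm_nonneg _)]
          ring
  have hs (g h : G) : Summable fun i => ‖⟪g, f i h⟫_ℂ‖ :=
    summable_of_sum_le (fun i => norm_nonneg _) fun s => bound s g h
  refine exists_wotHasSum (fun g h => (hs g h).of_norm) (√C * √D) fun g h => ?_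
  refine (norm_tsum_le_tsum_norm (hs g h)).trans ?_
  exact (hs g h).tsum_le_of_sum_le fun s => bound s g h

omit [CompleteSpace G] in
theorem WotHasSum.sum_re_le {ι : Type*} {p : ι → G →L[ℂ] G} {P : G →L[ℂ] G}
    (h : WotHasSum p P) (hp : ∀ i, (p i).IsPositive) (s : Finset ι) (g : G) :
    ∑ i ∈ s, RCLike.re ⟪g, p i g⟫_ℂ ≤ RCLike.re ⟪g, P g⟫_ℂ :=
  sum_le_hasSum s (fun i _ => (hp i).re_inner_nonneg_right g) (h.re_hasSum g g)

omit [CompleteSpace G] in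
theorem WotHasSum.dominated {ι : Type*} {f p q : ι → G →L[ℂ] G} {F P Q : G →L[ℂ] G}
    (hd : ∀ i, Dominated (f i) (p i) (q i)) (hf : WotHasSum f F) (hp : WotHasSum p P)
    (hq : WotHasSum q Q) : Dominated F P Q := by
  refine ⟨hp.isPositive fun i => (hd i).left, hq.isPositive fun i => (hd i).right,
    fun g h => ?_⟩
  refine le_of_tendsto (hf g h).norm (Filter.Eventually.of_forall fun s => ?_)
  calc ‖∑ i ∈ s, ⟪g, f i h⟫_ℂ‖ ≤ ∑ i ∈ s, ‖⟪g, f i h⟫_ℂ‖ := norm_sum_le _ _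
    _ ≤ ∑ i ∈ s, √(RCLike.re ⟪g, p i g⟫_ℂ) * √(RCLike.re ⟪h, q i h⟫_ℂ) :=
          Finset.sum_le_sum fun i _ => (hd i).le g h
    _ ≤ √(∑ i ∈ s, RCLike.re ⟪g, p i g⟫_ℂ) * √(∑ i ∈ s, RCLike.re ⟪h, q i h⟫_ℂ) :=
          Real.sum_sqrt_mul_sqrt_le s (fun i => (hd i).left.re_inner_nonneg_right g)
            (fun i => (hd i).right.re_inner_nonneg_right h)
    _ ≤ _ := by
          gcongr
          · exact hp.sum_re_le (fun i => (hd i).left) s g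
          · exact hq.sum_re_le (fun i => (hd i).right) s h

theorem exists_wotHasSum_of_dominated {ι : Type*} {f p q : ι → G →L[ℂ] G} {P Q : G →L[ℂ] G}
    (hd : ∀ i, Dominated (f i) (p i) (q i)) (hp : WotHasSum p P) (hq : WotHasSum q Q) :
    ∃ F, WotHasSum f F :=
  exists_wotHasSum_of_dominated_of_le hd
    (fun s g => (hp.sum_re_le (fun i => (hd i).left) s g).trans (re_inner_le_norm_mul _ _))
    (fun s g => (hq.sum_re_le (fun i => (hd i).right) s g).trans (re_inner_le_norm_mul _ _))

theorem exists_wotHasSum_of_isPositive {ι : Type*} {p : ι → G →L[ℂ] G}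
    (hp : ∀ i, (p i).IsPositive) {C : ℝ}
    (hC : ∀ (s : Finset ι) (g : G), ∑ i ∈ s, RCLike.re ⟪g, p i g⟫_ℂ ≤ C * ‖g‖ ^ 2) :
    ∃ P, WotHasSum p P :=
  exists_wotHasSum_of_dominated_of_le (fun i => IsPositive.dominated (hp i)) hC hC

theorem IsPositive.norm_le_of_re_inner_le {p : G →L[ℂ] G} (hp : p.IsPositive) {C : ℝ}
    (hC0 : 0 ≤ C) (hC : ∀ g : G, RCLike.re ⟪g, p g⟫_ℂ ≤ C * ‖g‖ ^ 2) : ‖p‖ ≤ C := by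
  refine ((IsPositive.dominated hp).norm_le_of_le hC hC).trans_eq ?_
  exact Real.mul_self_sqrt hC0

end Dominated

/-! ### The maps `a ↦ T^{(k)} (Y_k ⊗ a) L^{(k)*}` and `Φ_{T,L}` -/

section RowTerm

variable {G : Type u} [NormedAddCommGroup G] [InnerProductSpace ℂ G] [CompleteSpace G] {d : ℕ}

theorem rowTerm_add (Y : WeightSeq d) (T L : Fin d → G →L[ℂ] G) (a b : G →L[ℂ] G) (k : ℕ) :
    rowTerm Y T L (a + b) k = rowTerm Y T L a k + rowTerm Y T L b k := by
  simp only [rowTerm, mul_add, add_mul, smul_add, Finset.sum_add_distrib]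

theorem rowTerm_smul (Y : WeightSeq d) (T L : Fin d → G →L[ℂ] G) (c : ℂ) (a : G →L[ℂ] G) (k : ℕ) :
    rowTerm Y T L (c • a) k = c • rowTerm Y T L a k := by
  simp only [rowTerm, mul_smul_comm, smul_mul_assoc, Finset.smul_sum, smul_comm c]

theorem rowTerm_zero (Y : WeightSeq d) (T L : Fin d → G →L[ℂ] G) (k : ℕ) :
    rowTerm Y T L 0 k = 0 := by
  simp [rowTerm]

theorem rowTerm_sum (Y : WeightSeq d) (T L : Fin d → G →L[ℂ] G) {ι : Type*} (s : Finset ι)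
    (a : ι → G →L[ℂ] G) (k : ℕ) :
    rowTerm Y T L (∑ i ∈ s, a i) k = ∑ i ∈ s, rowTerm Y T L (a i) k := by
  induction s using Finset.cons_induction with
  | empty => simp [rowTerm_zero]
  | cons i s hi ih => simp [rowTerm_add, ih]

/-- The column `γ ↦ ∑_β c_{γ,β} T_β^* g`. -/
def wordCol {k : ℕ} (C : Matrix (Fin k → Fin d) (Fin k → Fin d) ℂ) (T : Fin d → G →L[ℂ] G) (g : G)
    (γ : Fin k → Fin d) : G :=
  ∑ β, C γ β • star (wordProd T β) g

theorem exists_eq_conjTranspose_mul_self {n : Type*} [Fintype n] {A : Matrix n n ℂ}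
    (hA : A.PosSemidef) : ∃ C : Matrix n n ℂ, A = C.conjTranspose * C := by
  classical
  open scoped MatrixOrder in
  obtain ⟨C, hC⟩ := CStarAlgebra.nonneg_iff_eq_star_mul_self.1 hA.nonneg
  exact ⟨C, hC⟩

/-- Factoring the weight as C*C makes the form diagonal in a middle index γ, with the same columns
for every a. Positivity, Cauchy–Schwarz and normality are all read off from this. -/
theorem inner_rowTerm {Y : WeightSeq d} {k : ℕ} {C : Matrix (Fin k → Fin d) (Fin k → Fin d) ℂ}
    (hC : Y k = C.conjTranspose * C) (T L : Fin d → G →L[ℂ] G) (a : G →L[ℂ] G) (g h : G) :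
    ⟪g, rowTerm Y T L a k h⟫_ℂ = ∑ γ, ⟪wordCol C T g γ, a (wordCol C L h γ)⟫_ℂ := by
  simp only [rowTerm, wordCol, hC, Matrix.mul_apply, Matrix.conjTranspose_apply, map_sum, map_smul,
    sum_inner, inner_sum, inner_smul_left, inner_smul_right, sum_apply, smul_apply,
    mul_apply_eq_comp, Finset.sum_mul, ContinuousLinearMap.star_eq_adjoint,
    ContinuousLinearMap.adjoint_inner_left]
  rw [Finset.sum_comm' (t' := Finset.univ) (s' := fun _ => Finset.univ) (by simp)]
  conv_rhs => rw [Finset.sum_comm]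
  refine Finset.sum_congr rfl fun β _ => ?_
  rw [Finset.sum_comm]
  refine Finset.sum_congr rfl fun γ _ => ?_
  rw [Finset.mul_sum]
  refine Finset.sum_congr rfl fun α _ => ?_
  rw [starRingEnd_apply]
  ring

/-- In the form of `inner_rowTerm` the domination applies for each γ separately, and Cauchy–Schwarz
over γ reassembles the sum. -/
theorem Dominated.rowTerm {Y : WeightSeq d} {k : ℕ} (hY : (Y k).PosSemidef)
    (T L : Fin d → G →L[ℂ] G) {f p q : G →L[ℂ] G} (h : Dominated f p q) :
    Dominated (rowTerm Y T L f k) (rowTerm Y T T p k) (rowTerm Y L L q k) := by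
  obtain ⟨C, hC⟩ := exists_eq_conjTranspose_mul_self hY
  have pos {p : G →L[ℂ] G} (hp : p.IsPositive) (T : Fin d → G →L[ℂ] G) :
      (RKCorr.rowTerm Y T T p k).IsPositive := by
    refine isPositive_of_inner_nonneg fun g => ?_
    rw [inner_rowTerm hC]
    exact Finset.sum_nonneg fun γ _ => hp.inner_nonneg_right _
  refine ⟨pos h.left T, pos h.right L, fun x y => ?_⟩
  simp only [inner_rowTerm hC, map_sum]
  calc _ ≤ ∑ γ, ‖⟪wordCol C T x γ, f (wordCol C L y γ)⟫_ℂ‖ := norm_sum_le _ _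
    _ ≤ _ := Finset.sum_le_sum fun γ _ => h.le _ _
    _ ≤ _ := Real.sum_sqrt_mul_sqrt_le _ (fun γ => h.left.re_inner_nonneg_right _)
        (fun γ => h.right.re_inner_nonneg_right _)

/-- The series of `Φ_T(I)` converges. -/
abbrev PhiSummable (X : WeightSeq d) (T : Fin d → G →L[ℂ] G) : Prop :=
  WotSummable fun k => rowTerm X T T 1 (k + 1)

variable {X : WeightSeq d} {T L : Fin d → G →L[ℂ] G}

omit [CompleteSpace G] in
theorem WotHasSum.smul {ι : Type*} {f : ι → G →L[ℂ] G} {A : G →L[ℂ] G} (hf : WotHasSum f A)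
    (c : ℂ) : WotHasSum (fun i => c • f i) (c • A) := fun g h => by
  simpa only [smul_apply, inner_smul_right] using (hf g h).mul_left c

omit [CompleteSpace G] in
theorem WotHasSum.add {ι : Type*} {f f' : ι → G →L[ℂ] G} {A A' : G →L[ℂ] G} (hf : WotHasSum f A)
    (hf' : WotHasSum f' A') : WotHasSum (fun i => f i + f' i) (A + A') := fun g h => by
  simpa only [add_apply, inner_add_right] using (hf g h).add (hf' g h)

theorem phi_hasSum (hX : ∀ k, 1 ≤ k → (X k).PosSemidef) (hT : PhiSummable X T)
    (hL : PhiSummable X L) (a : G →L[ℂ] G) :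
    WotHasSum (fun k => rowTerm X T L a (k + 1)) (Phi X T L a) := by
  obtain ⟨F, hF⟩ := exists_wotHasSum_of_dominated
    (fun k => (dominated_norm a).rowTerm (hX (k + 1) (by simp)) T L)
    (by simpa only [rowTerm_smul] using hT.hasSum.smul (‖a‖ : ℂ))
    (by simpa only [rowTerm_smul] using hL.hasSum.smul (‖a‖ : ℂ))
  exact hF.summable.hasSum

theorem Dominated.phi (hX : ∀ k, 1 ≤ k → (X k).PosSemidef) (hT : PhiSummable X T)
    (hL : PhiSummable X L) {f p q : G →L[ℂ] G} (h : Dominated f p q) :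
    Dominated (Phi X T L f) (Phi X T T p) (Phi X L L q) :=
  WotHasSum.dominated (fun k => h.rowTerm (hX (k + 1) (by simp)) T L)
    (phi_hasSum hX hT hL f) (phi_hasSum hX hT hT p) (phi_hasSum hX hL hL q)

theorem phi_add (hX : ∀ k, 1 ≤ k → (X k).PosSemidef) (hT : PhiSummable X T)
    (hL : PhiSummable X L) (a b : G →L[ℂ] G) :
    Phi X T L (a + b) = Phi X T L a + Phi X T L b := by
  refine WotHasSum.wotSum_eq ?_
  simpa only [rowTerm_add] using (phi_hasSum hX hT hL a).add (phi_hasSum hX hT hL b)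

theorem phi_smul (hX : ∀ k, 1 ≤ k → (X k).PosSemidef) (hT : PhiSummable X T)
    (hL : PhiSummable X L) (c : ℂ) (a : G →L[ℂ] G) :
    Phi X T L (c • a) = c • Phi X T L a := by
  refine WotHasSum.wotSum_eq ?_
  simpa only [rowTerm_smul] using (phi_hasSum hX hT hL a).smul c

theorem norm_phi_le (hX : ∀ k, 1 ≤ k → (X k).PosSemidef) (hT : PhiSummable X T)
    (hL : PhiSummable X L) (a : G →L[ℂ] G) :
    ‖Phi X T L a‖ ≤ √‖Phi X T T 1‖ * √‖Phi X L L 1‖ * ‖a‖ := by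
  refine ((dominated_norm a).phi hX hT hL).norm_le.trans_eq ?_
  rw [phi_smul hX hT hT, phi_smul hX hL hL, norm_smul, norm_smul, Real.sqrt_mul (norm_nonneg _),
    Real.sqrt_mul (norm_nonneg _), Complex.norm_real, norm_norm]
  calc _ = (√‖a‖ * √‖a‖) * (√‖Phi X T T 1‖ * √‖Phi X L L 1‖) := by ring
    _ = _ := by rw [Real.mul_self_sqrt (norm_nonneg _)]; ring

/-- `Φ_{T,L}` as a bounded linear map. -/
def phiCLM (hX : ∀ k, 1 ≤ k → (X k).PosSemidef) (hT : PhiSummable X T)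
    (hL : PhiSummable X L) : (G →L[ℂ] G) →L[ℂ] (G →L[ℂ] G) :=
  LinearMap.mkContinuous
    { toFun := Phi X T L
      map_add' := phi_add hX hT hL
      map_smul' := phi_smul hX hT hL }
    (√‖Phi X T T 1‖ * √‖Phi X L L 1‖) (norm_phi_le hX hT hL)

/-- This makes id - Φ_{T,L} invertible by a Neumann series and makes the iterates of Φ_T decay
geometrically. -/
theorem norm_phiCLM_lt (hX : ∀ k, 1 ≤ k → (X k).PosSemidef) (hT : PhiSummable X T)
    (hL : PhiSummable X L) (hT1 : ‖Phi X T T 1‖ < 1) (hL1 : ‖Phi X L L 1‖ < 1) :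
    ‖phiCLM hX hT hL‖ < 1 := by
  refine (LinearMap.mkContinuous_norm_le _ (by positivity) _).trans_lt ?_
  have h1 : √‖Phi X T T 1‖ < 1 := by rwa [Real.sqrt_lt' one_pos, one_pow]
  have h2 : √‖Phi X L L 1‖ < 1 := by rwa [Real.sqrt_lt' one_pos, one_pow]
  exact mul_lt_one_of_nonneg_of_lt_one_left (by positivity) h1 h2.le

theorem phi_sub (hX : ∀ k, 1 ≤ k → (X k).PosSemidef) (hT : PhiSummable X T)
    (hL : PhiSummable X L) (a b : G →L[ℂ] G) :
    Phi X T L (a - b) = Phi X T L a - Phi X T L b :=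
  map_sub (phiCLM hX hT hL) a b

/-- A domination carries the positivity of its bounds, so it suffices to dominate the zero operator
by p on both sides. -/
theorem phi_isPositive (hX : ∀ k, 1 ≤ k → (X k).PosSemidef) (hT : PhiSummable X T)
    {p : G →L[ℂ] G} (hp : p.IsPositive) : (Phi X T T p).IsPositive :=
  ((dominated_zero hp hp).phi hX hT hT).left

theorem phi_mono (hX : ∀ k, 1 ≤ k → (X k).PosSemidef) (hT : PhiSummable X T) :
    Monotone (Phi X T T) := by
  intro p q hpq
  rw [ContinuousLinearMap.le_def, ← phi_sub hX hT hT]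
  exact phi_isPositive hX hT hpq

end RowTerm

/-! ### Compression by intertwining operators -/

section Intertwine

variable {G : Type u} [NormedAddCommGroup G] [InnerProductSpace ℂ G] [CompleteSpace G]
  {F : Type v} [NormedAddCommGroup F] [InnerProductSpace ℂ F] [CompleteSpace F] {d : ℕ}

theorem adjoint_comp_wordProd {E : G →L[ℂ] F} {M : Fin d → F →L[ℂ] F} {T : Fin d → G →L[ℂ] G}
    (hM : ∀ i, ContinuousLinearMap.adjoint E ∘L M i = T i ∘L ContinuousLinearMap.adjoint E)
    {k : ℕ} (α : Fin k → Fin d) :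
    ContinuousLinearMap.adjoint E ∘L wordProd M α =
      wordProd T α ∘L ContinuousLinearMap.adjoint E := by
  simp only [wordProd]
  have key (l : List (Fin d)) : ContinuousLinearMap.adjoint E ∘L (l.map M).prod =
      (l.map T).prod ∘L ContinuousLinearMap.adjoint E := by
    induction l with
    | nil => ext; simp
    | cons i l ih =>
      have e1 : ((i :: l).map M).prod = M i ∘L (l.map M).prod := by simp; rfl
      have e2 : ((i :: l).map T).prod = T i ∘L (l.map T).prod := by simp; rfl
      rw [e1, e2, ← ContinuousLinearMap.comp_assoc, hM, ContinuousLinearMap.comp_assoc, ih,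
        ContinuousLinearMap.comp_assoc]
  simpa [List.map_ofFn, Function.comp_def] using key (List.ofFn α)

/-- If `E^* M_i = T_i E^*` and `D^* M_i = L_i D^*`, then compressing
`M^{(k)} (Y_k ⊗ a) M^{(k)*}` gives `T^{(k)} (Y_k ⊗ E^* a D) L^{(k)*}`. -/
theorem adjoint_comp_rowTerm_comp {E D : G →L[ℂ] F} {M : Fin d → F →L[ℂ] F}
    {T L : Fin d → G →L[ℂ] G}
    (hT : ∀ i, ContinuousLinearMap.adjoint E ∘L M i = T i ∘L ContinuousLinearMap.adjoint E)
    (hL : ∀ i, ContinuousLinearMap.adjoint D ∘L M i = L i ∘L ContinuousLinearMap.adjoint D)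
    (Y : WeightSeq d) (a : F →L[ℂ] F) (k : ℕ) :
    ContinuousLinearMap.adjoint E ∘L rowTerm Y M M a k ∘L D =
      rowTerm Y T L (ContinuousLinearMap.adjoint E ∘L a ∘L D) k := by
  have h2 (β : Fin k → Fin d) (h : G) : star (wordProd M β) (D h) = D (star (wordProd L β) h) := by
    have := congrArg ContinuousLinearMap.adjoint (adjoint_comp_wordProd hL β)
    simp only [ContinuousLinearMap.adjoint_comp, ContinuousLinearMap.adjoint_adjoint] at this
    exact congrArg (fun A : G →L[ℂ] F => A h) this
  have h1 (α : Fin k → Fin d) (x : F) : ContinuousLinearMap.adjoint E (wordProd M α x) =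
      wordProd T α (ContinuousLinearMap.adjoint E x) :=
    congrArg (fun A : F →L[ℂ] G => A x) (adjoint_comp_wordProd hT α)
  ext h
  simp [rowTerm, sum_apply, h1, h2, map_sum]

/-- Fixed outer factors E* and D preserve weak sums, so the identity holds term by term. Convergence
of the series for T and L is inherited from that for M. -/
theorem adjoint_comp_phi_comp {E D : G →L[ℂ] F} {M : Fin d → F →L[ℂ] F} {T L : Fin d → G →L[ℂ] G}
    (hT : ∀ i, ContinuousLinearMap.adjoint E ∘L M i = T i ∘L ContinuousLinearMap.adjoint E)
    (hL : ∀ i, ContinuousLinearMap.adjoint D ∘L M i = L i ∘L ContinuousLinearMap.adjoint D)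
    {X : WeightSeq d} (hX : ∀ k, 1 ≤ k → (X k).PosSemidef) (hM : PhiSummable X M)
    (a : F →L[ℂ] F) :
    ContinuousLinearMap.adjoint E ∘L Phi X M M a ∘L D =
      Phi X T L (ContinuousLinearMap.adjoint E ∘L a ∘L D) := by
  symm
  refine WotHasSum.wotSum_eq fun g h => ?_
  simpa only [← adjoint_comp_rowTerm_comp hT hL, ContinuousLinearMap.comp_apply,
    ContinuousLinearMap.adjoint_inner_right] using phi_hasSum hX hM hM a (E g) (D h)

end Intertwine

/-! ### The weights `R_k ^ 2` and the kernel `K^R` -/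

section Compositions

variable {d : ℕ}

/-- Extension of a finite word to an infinite one by the first letter of the alphabet. -/
def wordExt (hd : 0 < d) {n : ℕ} (α : Fin n → Fin d) (m : ℕ) : Fin d :=
  if h : m < n then α ⟨m, h⟩ else ⟨0, hd⟩

/-- The entry of `X_{b_1} ⊗ ⋯ ⊗ X_{b_l}` at a pair of (infinite) words. -/
def listWeight (X : WeightSeq d) : List ℕ → (ℕ → Fin d) → (ℕ → Fin d) → ℂ
  | [], _, _ => 1
  | b :: l, U, V => X b (fun i => U i) (fun i => V i) *
      listWeight X l (fun m => U (b + m)) (fun m => V (b + m))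

/-- Block i starts after the blocks before it. With infinite words, removing a block is a shift and
no length has to be transported along an equality. -/
theorem prod_eq_listWeight (X : WeightSeq d) (l : List ℕ) (U V : ℕ → Fin d) :
    ∏ i : Fin l.length, X (l.get i) (fun j => U ((l.take i).sum + j))
      (fun j => V ((l.take i).sum + j)) = listWeight X l U V := by
  induction l generalizing U V with
  | nil => simp [listWeight]
  | cons b l ih =>
    rw [listWeight, ← ih]
    refine (Fin.prod_univ_succ (n := l.length) _).trans ?_
    congr 1
    · simp
      rfl
    · refine Finset.prod_congr rfl fun i _ => ?_
      simp [add_assoc]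

theorem rsq_apply (X : WeightSeq d) (hd : 0 < d) {n : ℕ} (α β : Fin n → Fin d) :
    Rsq X n α β = ∑ c : Composition n, listWeight X c.blocks (wordExt hd α) (wordExt hd β) := by
  simp only [Rsq, Matrix.of_apply]
  refine Finset.sum_congr rfl fun c _ => ?_
  rw [← prod_eq_listWeight]
  refine Finset.prod_congr rfl fun i _ => ?_
  have key (α : Fin n → Fin d) (j : Fin (c.blocksFun i)) :
      (α ∘ c.embedding i) j = wordExt hd α ((c.blocks.take i).sum + j) := by
    have h : c.sizeUpTo i + j < n := by
      rw [← Composition.coe_embedding]; exact (c.embedding i j).2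
    have h' : (c.blocks.take i).sum + j < n := h
    rw [wordExt, dif_pos h', Function.comp_apply]
    congr 1
  change X (c.blocksFun i) _ _ = X (c.blocksFun i) _ _
  congr 1 <;> exact funext fun j => key _ j

variable {G : Type u} [NormedAddCommGroup G] [InnerProductSpace ℂ G]

theorem wordProd_append (T : Fin d → G →L[ℂ] G) {m n : ℕ} (α : Fin m → Fin d) (β : Fin n → Fin d) :
    wordProd T (Fin.append α β) = wordProd T α * wordProd T β := by
  have h : (fun i => T (Fin.append α β i)) = Fin.append (T ∘ α) (T ∘ β) := by
    ext i : 1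
    refine Fin.addCases (fun j => ?_) (fun j => ?_) i <;> simp
  rw [wordProd, h, List.ofFn_fin_append, List.prod_append]
  rfl

theorem wordExt_append_left (hd : 0 < d) {m n : ℕ} (α : Fin m → Fin d) (β : Fin n → Fin d) :
    (fun i : Fin m => wordExt hd (Fin.append α β) i) = α := by
  ext i : 1
  rw [wordExt, dif_pos (by omega)]
  exact Fin.append_left α β i

theorem wordExt_append_right (hd : 0 < d) {m n : ℕ} (α : Fin m → Fin d) (β : Fin n → Fin d) :
    (fun i => wordExt hd (Fin.append α β) (m + i)) = wordExt hd β := by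
  ext i : 1
  by_cases h : i < n
  · rw [wordExt, wordExt, dif_pos h, dif_pos (by omega)]
    exact Fin.append_right α β ⟨i, h⟩
  · rw [wordExt, wordExt, dif_neg h, dif_neg (by omega)]

variable [CompleteSpace G]

/-- `Φ_{b_1} ∘ ⋯ ∘ Φ_{b_l}`, where `Φ_b(a) = T^{(b)} (X_b ⊗ a) L^{(b)*}`. -/
def listTerm (X : WeightSeq d) (T L : Fin d → G →L[ℂ] G) (a : G →L[ℂ] G) (l : List ℕ) : G →L[ℂ] G :=
  l.foldr (fun b A => rowTerm X T L A b) a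

/-- Cutting α = α₁α₂ and β = β₁β₂ factors the weight. The adjoint reverses the order of L_β, so the
part belonging to the remaining blocks is nested inside that of the first block: tensor products of
weights act as compositions of maps. -/
theorem sum_listWeight_smul (X : WeightSeq d) (hd : 0 < d) (T L : Fin d → G →L[ℂ] G)
    (a : G →L[ℂ] G) (l : List ℕ) {n : ℕ} (hn : l.sum = n) :
    ∑ α : Fin n → Fin d, ∑ β : Fin n → Fin d, listWeight X l (wordExt hd α) (wordExt hd β) •
      (wordProd T α * a * star (wordProd L β)) = listTerm X T L a l := by
  induction l generalizing n with
  | nil =>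
    obtain rfl : 0 = n := by simpa using hn
    simp [listWeight, listTerm, wordProd]
  | cons b l ih =>
    obtain rfl : b + l.sum = n := by simpa using hn
    have e : listTerm X T L a (b :: l) = rowTerm X T L (listTerm X T L a l) b := rfl
    rw [e, ← ih rfl, ← (Fin.appendEquiv b l.sum).sum_comp, Fintype.sum_prod_type]
    refine Eq.trans (Finset.sum_congr rfl fun α₁ _ => Finset.sum_congr rfl fun α₂ _ => ?_)
      (b := ∑ α₁ : Fin b → Fin d, ∑ α₂ : Fin l.sum → Fin d, ∑ β₁ : Fin b → Fin d,
        ∑ β₂ : Fin l.sum → Fin d, X b α₁ β₁ • listWeight X l (wordExt hd α₂) (wordExt hd β₂) •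
        (wordProd T α₁ * (wordProd T α₂ * a * star (wordProd L β₂)) * star (wordProd L β₁))) ?_
    · rw [← (Fin.appendEquiv b l.sum).sum_comp, Fintype.sum_prod_type]
      refine Finset.sum_congr rfl fun β₁ _ => Finset.sum_congr rfl fun β₂ _ => ?_
      change listWeight X (b :: l) (wordExt hd (Fin.append α₁ α₂)) (wordExt hd (Fin.append β₁ β₂)) •
        (wordProd T (Fin.append α₁ α₂) * a * star (wordProd L (Fin.append β₁ β₂))) = _
      rw [listWeight, wordExt_append_left, wordExt_append_left, wordExt_append_right,
        wordExt_append_right, wordProd_append, wordProd_append, mul_smul, star_mul]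
      simp only [mul_assoc]
    · rw [rowTerm]
      refine Finset.sum_congr rfl fun α₁ _ => ?_
      rw [Finset.sum_comm]
      refine Finset.sum_congr rfl fun β₁ _ => ?_
      simp only [Finset.mul_sum, Finset.sum_mul, Finset.smul_sum, mul_smul_comm, smul_mul_assoc]

theorem rowTerm_rsq (X : WeightSeq d) (hd : 0 < d) (T L : Fin d → G →L[ℂ] G) (a : G →L[ℂ] G)
    (n : ℕ) :
    rowTerm (Rsq X) T L a n = ∑ c : Composition n, listTerm X T L a c.blocks := by
  simp only [rowTerm, rsq_apply X hd, Finset.sum_smul]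
  rw [Finset.sum_congr rfl fun α _ => Finset.sum_comm, Finset.sum_comm]
  exact Finset.sum_congr rfl fun c _ => sum_listWeight_smul X hd T L a c.blocks c.blocks_sum

/-- A composition of n + 1 is a first block, of positive size p.1 + 1, followed by a composition of
the rest p.2. -/
theorem sum_composition_succ {M : Type*} [AddCommMonoid M] (F : List ℕ → M) (n : ℕ) :
    ∑ c : Composition (n + 1), F c.blocks =
      ∑ p ∈ Finset.HasAntidiagonal.antidiagonal n,
        ∑ c : Composition p.2, F ((p.1 + 1) :: c.blocks) := by
  rw [Finset.sum_sigma']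
  symm
  refine Finset.sum_bij
    (fun (x : Σ p : ℕ × ℕ, Composition p.2) hx => Composition.mk ((x.1.1 + 1) :: x.2.blocks)
      (fun hi => ?_) ?_) (fun _ _ => Finset.mem_univ _) ?_ ?_ (fun _ _ => rfl)
  · rcases List.mem_cons.1 hi with rfl | h
    · exact Nat.succ_pos _
    · exact x.2.blocks_pos h
  · have := Finset.HasAntidiagonal.mem_antidiagonal.1 (Finset.mem_sigma.1 hx).1
    rw [List.sum_cons, x.2.blocks_sum]
    omega
  · rintro ⟨⟨i, j⟩, c⟩ hx ⟨⟨i', j'⟩, c'⟩ hx' h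
    have h1 := Finset.HasAntidiagonal.mem_antidiagonal.1 (Finset.mem_sigma.1 hx).1
    have h2 := Finset.HasAntidiagonal.mem_antidiagonal.1 (Finset.mem_sigma.1 hx').1
    have h3 := congrArg Composition.blocks h
    simp only [List.cons.injEq, Nat.add_right_cancel_iff] at h1 h2 h3
    obtain ⟨rfl, h4⟩ := h3
    obtain rfl : j = j' := by omega
    obtain rfl : c = c' := Composition.ext h4
    rfl
  · rintro ⟨l, hpos, hsum⟩ -
    rcases l with _ | ⟨b, l⟩
    · simp at hsum
    · have hb : 0 < b := hpos (by simp)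
      rw [List.sum_cons] at hsum
      refine ⟨⟨(b - 1, l.sum), ⟨l, fun h => hpos (by simp [h]), rfl⟩⟩, ?_, ?_⟩
      · simp; omega
      · simp [Nat.sub_add_cancel hb]

/-- `T^{(n+1)} (R_{n+1}^2 ⊗ a) L^{(n+1)*} = ∑_{j+k=n} Φ_{j+1}(T^{(k)} (R_k^2 ⊗ a) L^{(k)*})`. -/
theorem rowTerm_rsq_succ (X : WeightSeq d) (hd : 0 < d) (T L : Fin d → G →L[ℂ] G) (a : G →L[ℂ] G)
    (n : ℕ) :
    rowTerm (Rsq X) T L a (n + 1) = ∑ p ∈ Finset.HasAntidiagonal.antidiagonal n,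
      rowTerm X T L (rowTerm (Rsq X) T L a p.2) (p.1 + 1) := by
  rw [rowTerm_rsq X hd, sum_composition_succ]
  refine Finset.sum_congr rfl fun p _ => ?_
  rw [rowTerm_rsq X hd, rowTerm_sum]
  rfl

theorem rowTerm_rsq_zero (X : WeightSeq d) (hd : 0 < d) (T L : Fin d → G →L[ℂ] G) (a : G →L[ℂ] G) :
    rowTerm (Rsq X) T L a 0 = a := by
  rw [rowTerm_rsq X hd]
  have (c : Composition 0) : c.blocks = [] := by
    have h := c.blocks_sum
    rcases hb : c.blocks with _ | ⟨b, l⟩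
    · rfl
    · have hp : 0 < b := c.blocks_pos (by simp [hb])
      simp [hb] at h; omega
  simp [this, listTerm, composition_card]

variable {X : WeightSeq d} {T L : Fin d → G →L[ℂ] G}

/-- The recursion `rowTerm_rsq_succ` uses only the weights X_k, so positivity of the matrices R_k²
is not needed. -/
theorem Dominated.rowTerm_rsq (hd : 0 < d) (hX : ∀ k, 1 ≤ k → (X k).PosSemidef)
    (T L : Fin d → G →L[ℂ] G) {f p q : G →L[ℂ] G} (h : Dominated f p q) (n : ℕ) :
    Dominated (RKCorr.rowTerm (Rsq X) T L f n) (RKCorr.rowTerm (Rsq X) T T p n)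
      (RKCorr.rowTerm (Rsq X) L L q n) := by
  induction n using Nat.strong_induction_on with
  | _ n ih =>
    rcases n with _ | n
    · simpa only [rowTerm_rsq_zero X hd] using h
    · simp only [rowTerm_rsq_succ X hd]
      refine Dominated.sum _ fun p hp => (ih p.2 ?_).rowTerm (hX _ (by simp)) T L
      have := Finset.HasAntidiagonal.mem_antidiagonal.1 hp
      omega

/-- The partial sums of the series of `K^R(T,T)(I)` are bounded by `(1 - ‖Φ_T(I)‖)⁻¹`. -/
theorem norm_sum_rowTerm_rsq_le (hd : 0 < d) (hX : ∀ k, 1 ≤ k → (X k).PosSemidef)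
    (hT : PhiSummable X T) (hT1 : ‖Phi X T T 1‖ < 1) (N : ℕ) :
    ‖∑ k ∈ Finset.range N, rowTerm (Rsq X) T T 1 k‖ ≤ (1 - ‖Phi X T T 1‖)⁻¹ := by
  have hA (k : ℕ) : (rowTerm (Rsq X) T T 1 k).IsPositive :=
    (IsPositive.dominated ContinuousLinearMap.isPositive_one).rowTerm_rsq hd hX T T k |>.left
  have hB (j : ℕ) {p : G →L[ℂ] G} (hp : p.IsPositive) : (rowTerm X T T p (j + 1)).IsPositive :=
    ((dominated_zero hp hp).rowTerm (hX (j + 1) (by simp)) T T).left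
  have hP (N : ℕ) : (∑ k ∈ Finset.range N, rowTerm (Rsq X) T T 1 k).IsPositive :=
    ContinuousLinearMap.isPositive_sum _ fun k _ => hA k
  induction N with
  | zero =>
    simp only [Finset.range_zero, Finset.sum_empty, norm_zero, inv_nonneg]
    linarith
  | succ N ih =>
    set r := ‖Phi X T T 1‖
    set P := ∑ k ∈ Finset.range N, rowTerm (Rsq X) T T 1 k with hPdef
    have hr : 0 < 1 - r := by linarith
    have hr0 : 0 ≤ r := norm_nonneg _
    refine IsPositive.norm_le_of_re_inner_le (hP _) (by positivity) fun g => ?_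
    -- By the recursion the new partial sum is I plus the sum of these terms over a triangle.
    -- Enlarging the triangle to a square bounds it by I + Φ_T(P).
    let F : ℕ × ℕ → ℝ := fun p =>
      RCLike.re ⟪g, rowTerm X T T (rowTerm (Rsq X) T T 1 p.2) (p.1 + 1) g⟫_ℂ
    have hF (p : ℕ × ℕ) : 0 ≤ F p := (hB _ (hA _)).re_inner_nonneg_right g
    have h1 : RCLike.re ⟪g, (∑ k ∈ Finset.range (N + 1), rowTerm (Rsq X) T T 1 k) g⟫_ℂ =
        ∑ n ∈ Finset.range N, ∑ p ∈ Finset.HasAntidiagonal.antidiagonal n, F p + ‖g‖ ^ 2 := by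
      rw [Finset.sum_range_succ']
      simp only [rowTerm_rsq_succ X hd, rowTerm_rsq_zero X hd, add_apply, sum_apply,
        inner_add_right, inner_sum, map_add, map_sum, one_apply_eq_self, inner_self_eq_norm_sq]
      rfl
    have h2 : ∑ n ∈ Finset.range N, ∑ p ∈ Finset.HasAntidiagonal.antidiagonal n, F p ≤
        ∑ p ∈ Finset.range N ×ˢ Finset.range N, F p := by
      refine le_trans (le_of_eq ?_) (Finset.sum_fiberwise_le_sum_of_sum_fiber_nonneg
        (t := Finset.range N) (g := fun p : ℕ × ℕ => p.1 + p.2)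
        fun y _ => Finset.sum_nonneg fun p _ => hF p)
      refine Finset.sum_congr rfl fun n hn => Finset.sum_congr ?_ fun _ _ => rfl
      ext p
      simp only [Finset.HasAntidiagonal.mem_antidiagonal, Finset.mem_filter, Finset.mem_product,
        Finset.mem_range] at hn ⊢
      omega
    have h3 : ∑ p ∈ Finset.range N ×ˢ Finset.range N, F p =
        ∑ j ∈ Finset.range N, RCLike.re ⟪g, rowTerm X T T P (j + 1) g⟫_ℂ := by
      rw [Finset.sum_product]
      refine Finset.sum_congr rfl fun j _ => ?_
      rw [hPdef, rowTerm_sum, sum_apply, inner_sum, map_sum]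
    have h4 : ∑ j ∈ Finset.range N, RCLike.re ⟪g, rowTerm X T T P (j + 1) g⟫_ℂ ≤
        RCLike.re ⟪g, Phi X T T P g⟫_ℂ :=
      (phi_hasSum hX hT hT P).sum_re_le (fun j => hB j (hP N)) _ g
    have h5 : ‖Phi X T T P‖ ≤ r * (1 - r)⁻¹ := by
      refine (norm_phi_le hX hT hT P).trans ?_
      rw [Real.mul_self_sqrt hr0]
      gcongr
    -- The bound is the fixed point of t ↦ r t + 1, hence it survives the induction.
    have h6 : (1 - r)⁻¹ = r * (1 - r)⁻¹ + 1 := by field_simp; ring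
    rw [h1, h6, add_mul, one_mul]
    gcongr
    refine (h2.trans (h3.trans_le h4)).trans ((re_inner_le_norm_mul _ _).trans ?_)
    gcongr

theorem exists_wotHasSum_rowTerm_rsq_one (hd : 0 < d) (hX : ∀ k, 1 ≤ k → (X k).PosSemidef)
    (hT : PhiSummable X T) (hT1 : ‖Phi X T T 1‖ < 1) :
    ∃ P, WotHasSum (fun k => rowTerm (Rsq X) T T 1 k) P := by
  have hA (k : ℕ) : (rowTerm (Rsq X) T T 1 k).IsPositive :=
    (IsPositive.dominated ContinuousLinearMap.isPositive_one).rowTerm_rsq hd hX T T k |>.left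
  refine exists_wotHasSum_of_isPositive hA (C := (1 - ‖Phi X T T 1‖)⁻¹) fun s g => ?_
  obtain ⟨N, hN⟩ := s.exists_nat_subset_range
  calc _ ≤ ∑ k ∈ Finset.range N, RCLike.re ⟪g, rowTerm (Rsq X) T T 1 k g⟫_ℂ :=
        Finset.sum_le_sum_of_subset_of_nonneg hN fun k _ _ => (hA k).re_inner_nonneg_right g
    _ = RCLike.re ⟪g, (∑ k ∈ Finset.range N, rowTerm (Rsq X) T T 1 k) g⟫_ℂ := by
        rw [sum_apply, inner_sum, map_sum]
    _ ≤ _ := re_inner_le_norm_mul _ _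
    _ ≤ _ := by
        gcongr
        exact norm_sum_rowTerm_rsq_le hd hX hT hT1 N

theorem kr_hasSum (hd : 0 < d) (hX : ∀ k, 1 ≤ k → (X k).PosSemidef)
    (hT : PhiSummable X T) (hL : PhiSummable X L) (hT1 : ‖Phi X T T 1‖ < 1)
    (hL1 : ‖Phi X L L 1‖ < 1) (a : G →L[ℂ] G) :
    WotHasSum (fun k => rowTerm (Rsq X) T L a k) (KR X T L a) := by
  obtain ⟨P, hP⟩ := exists_wotHasSum_rowTerm_rsq_one hd hX hT hT1
  obtain ⟨Q, hQ⟩ := exists_wotHasSum_rowTerm_rsq_one hd hX hL hL1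
  obtain ⟨F, hF⟩ := exists_wotHasSum_of_dominated
    (fun k => (dominated_norm a).rowTerm_rsq hd hX T L k)
    (P := (‖a‖ : ℂ) • P) (Q := (‖a‖ : ℂ) • Q)
    (fun g h => by simpa only [rowTerm_smul] using hP.smul (‖a‖ : ℂ) g h)
    (fun g h => by simpa only [rowTerm_smul] using hQ.smul (‖a‖ : ℂ) g h)
  exact hF.summable.hasSum

/-- At a fixed length only finitely many words occur, so the map is weakly continuous. -/
theorem WotHasSum.rowTerm {ι : Type*} {f : ι → G →L[ℂ] G} {A : G →L[ℂ] G} (hf : WotHasSum f A)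
    (Y : WeightSeq d) (T L : Fin d → G →L[ℂ] G) (k : ℕ) :
    WotHasSum (fun i => RKCorr.rowTerm Y T L (f i) k) (RKCorr.rowTerm Y T L A k) := by
  intro g h
  have key (B : G →L[ℂ] G) : ⟪g, RKCorr.rowTerm Y T L B k h⟫_ℂ =
      ∑ α : Fin k → Fin d, ∑ β : Fin k → Fin d,
        Y k α β * ⟪star (wordProd T α) g, B (star (wordProd L β) h)⟫_ℂ := by
    simp [RKCorr.rowTerm, sum_apply,
      ContinuousLinearMap.star_eq_adjoint, ContinuousLinearMap.adjoint_inner_left]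
  simp only [key]
  exact hasSum_sum fun α _ => hasSum_sum fun β _ => (hf _ _).mul_left _

/-- `K^R(T,L)(a) - Φ_{T,L}(K^R(T,L)(a)) = a`. -/
theorem kr_sub_phi_kr (hd : 0 < d) (hX : ∀ k, 1 ≤ k → (X k).PosSemidef)
    (hT : PhiSummable X T) (hL : PhiSummable X L) (hT1 : ‖Phi X T T 1‖ < 1)
    (hL1 : ‖Phi X L L 1‖ < 1) (a : G →L[ℂ] G) :
    KR X T L a - Phi X T L (KR X T L a) = a := by
  refine ContinuousLinearMap.ext fun h => ext_inner_left ℂ fun g => ?_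
  -- Summing this array by rows gives Φ(K^R(a)); summing by antidiagonals gives K^R(a) - a, by the
  -- recursion.
  let F : ℕ × ℕ → ℂ := fun p => ⟪g, rowTerm X T L (rowTerm (Rsq X) T L a p.2) (p.1 + 1) h⟫_ℂ
  -- In the diagonal positive case the terms are nonnegative, so summability follows from the
  -- iterated sum.
  have hpos {T : Fin d → G →L[ℂ] G} (hT : PhiSummable X T) (hT1 : ‖Phi X T T 1‖ < 1) (g : G)
      (b : G →L[ℂ] G) (hb : b.IsPositive) :
      Summable fun p : ℕ × ℕ =>
        RCLike.re ⟪g, rowTerm X T T (rowTerm (Rsq X) T T b p.2) (p.1 + 1) g⟫_ℂ := by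
    have h1 (j : ℕ) := ((kr_hasSum hd hX hT hT hT1 hT1 b).rowTerm X T T (j + 1)).re_hasSum g g
    refine (summable_prod_of_nonneg fun p => ?_).2 ⟨fun j => (h1 j).summable, ?_⟩
    · exact (((dominated_zero hb hb).rowTerm_rsq hd hX T T p.2).rowTerm
        (hX (p.1 + 1) (by simp)) T T).left.re_inner_nonneg_right g
    · simp only [fun j => (h1 j).tsum_eq]
      exact ((phi_hasSum hX hT hT _).re_hasSum g g).summable
  have hdom (p : ℕ × ℕ) := ((dominated_norm a).rowTerm_rsq hd hX T L p.2).rowTerm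
        (hX (p.1 + 1) (by simp)) T L
  -- The general terms are at most √x √y ≤ x + y, with x and y from the positive arrays of T and L.
  have hF : Summable F := by
    refine Summable.of_norm_bounded ((hpos hT hT1 g _ (dominated_norm a).left).add
      (hpos hL hL1 h _ (dominated_norm a).left)) fun p => ((hdom p).le g h).trans ?_
    have e1 := (hdom p).left.re_inner_nonneg_right g
    have e2 := (hdom p).right.re_inner_nonneg_right h
    nlinarith [Real.sq_sqrt e1, Real.sq_sqrt e2, sq_nonneg (√(RCLike.re ⟪g, rowTerm X T T
      (rowTerm (Rsq X) T T ((‖a‖ : ℂ) • 1) p.2) (p.1 + 1) g⟫_ℂ) - √(RCLike.re ⟪h, rowTerm X L L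
      (rowTerm (Rsq X) L L ((‖a‖ : ℂ) • 1) p.2) (p.1 + 1) h⟫_ℂ))]
  have hKR := kr_hasSum hd hX hT hL hT1 hL1 a
  have h1 : ∑' p, F p = ⟪g, Phi X T L (KR X T L a) h⟫_ℂ :=
    (hF.hasSum.prod_fiberwise fun j => hKR.rowTerm X T L (j + 1) g h).unique
      (phi_hasSum hX hT hL _ g h)
  have h2 : HasSum (fun n => ⟪g, rowTerm (Rsq X) T L a (n + 1) h⟫_ℂ) (∑' p, F p) := by
    have h3 := (Finset.HasAntidiagonal.sigmaAntidiagonalEquivProd.hasSum_iff.2 hF.hasSum).sigma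
      fun n => hasSum_fintype _
    convert h3 using 2 with n
    rw [rowTerm_rsq_succ X hd, sum_apply, inner_sum, ← Finset.sum_coe_sort]
    rfl
  -- The term k = 0 of K^R(a) is a itself; removing it leaves the antidiagonal sum.
  have h3 := (hasSum_nat_add_iff' 1).2 (hKR g h)
  simp only [Finset.range_one, Finset.sum_singleton, rowTerm_rsq_zero X hd] at h3
  rw [sub_apply, inner_sub_right, ← h1, h2.unique h3, sub_sub_cancel]

end Compositions

/-! ### Normal maps -/

section Normal

variable {H : Type u} [NormedAddCommGroup H] [InnerProductSpace ℂ H]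

theorem summable_inner_of_summable_sq {ι : Type*} {x y : ι → H}
    (hx : Summable fun i => ‖x i‖ ^ 2) (hy : Summable fun i => ‖y i‖ ^ 2) (a : H →L[ℂ] H) :
    Summable fun i => ⟪x i, a (y i)⟫_ℂ := by
  refine Summable.of_norm_bounded ((hx.add hy).mul_left ‖a‖) fun i => ?_
  calc ‖⟪x i, a (y i)⟫_ℂ‖ ≤ ‖x i‖ * ‖a (y i)‖ := norm_inner_le_norm _ _
    _ ≤ ‖x i‖ * (‖a‖ * ‖y i‖) := by gcongr; exact a.le_opNorm _
    _ = ‖a‖ * (‖x i‖ * ‖y i‖) := by ring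
    _ ≤ ‖a‖ * (‖x i‖ ^ 2 + ‖y i‖ ^ 2) := by
        gcongr
        nlinarith [sq_nonneg (‖x i‖ - ‖y i‖), sq_nonneg ‖x i‖, sq_nonneg ‖y i‖]

/-- The index set embeds in ℕ, and the families are extended by zero. -/
theorem isNormalFunctional_of_countable {ι : Type*} [Countable ι] {x y : ι → H}
    (hx : Summable fun i => ‖x i‖ ^ 2) (hy : Summable fun i => ‖y i‖ ^ 2)
    {ω : (H →L[ℂ] H) → ℂ} (hω : ∀ a, ω a = ∑' i, ⟪x i, a (y i)⟫_ℂ) : IsNormalFunctional ω := by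
  obtain ⟨e, he⟩ := exists_injective_nat ι
  have hx0 (z : ι → H) (n : ℕ) (hn : n ∉ Set.range e) : Function.extend e z 0 n = 0 :=
    Function.extend_apply' _ _ _ hn
  refine ⟨Function.extend e x 0, Function.extend e y 0, ?_, ?_, fun a => ?_⟩
  · refine (he.summable_iff fun n hn => by simp [hx0 x n hn]).1 ?_
    simpa [Function.comp_def, he.extend_apply] using hx
  · refine (he.summable_iff fun n hn => by simp [hx0 y n hn]).1 ?_
    simpa [Function.comp_def, he.extend_apply] using hy
  · rw [hω, ← he.tsum_eq]
    · simp [he.extend_apply]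
    · intro n hn
      by_contra h
      exact hn (by simp [hx0 x n h])

theorem IsNormalFunctional.sub {ω ω' : (H →L[ℂ] H) → ℂ} (h : IsNormalFunctional ω)
    (h' : IsNormalFunctional ω') : IsNormalFunctional (fun a => ω a - ω' a) := by
  obtain ⟨x, y, hx, hy, hω⟩ := h
  obtain ⟨x', y', hx', hy', hω'⟩ := h'
  refine isNormalFunctional_of_countable (ι := ℕ ⊕ ℕ) (x := Sum.elim x x')
    (y := Sum.elim y (fun n => -y' n)) ?_ ?_ fun a => ?_
  · exact (Summable.sum (f := fun i => ‖Sum.elim x x' i‖ ^ 2) hx hx')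
  · exact (Summable.sum (f := fun i => ‖Sum.elim y (fun n => -y' n) i‖ ^ 2) hy
      (by simpa [Function.comp_def] using hy'))
  · have h1 := summable_inner_of_summable_sq hx hy a
    have h2 : Summable fun n => ⟪x' n, a (-y' n)⟫_ℂ := by
      simpa using (summable_inner_of_summable_sq hx' hy' a).neg
    rw [hω, hω', Summable.tsum_sum
      (f := fun i => ⟪Sum.elim x x' i, a (Sum.elim y (fun n => -y' n) i)⟫_ℂ) h1 h2]
    simp only [Sum.elim_inl, Sum.elim_inr, map_neg, inner_neg_right, tsum_neg, sub_eq_add_neg]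

theorem IsNormalFunctional.map_sub {ω : (H →L[ℂ] H) → ℂ} (h : IsNormalFunctional ω)
    (a b : H →L[ℂ] H) : ω (a - b) = ω a - ω b := by
  obtain ⟨x, y, hx, hy, hω⟩ := h
  rw [hω, hω, hω, ← (summable_inner_of_summable_sq hx hy a).tsum_sub
    (summable_inner_of_summable_sq hx hy b)]
  simp

theorem IsNormalMap.comp {φ ψ : (H →L[ℂ] H) → (H →L[ℂ] H)} (hφ : IsNormalMap φ)
    (hψ : IsNormalMap ψ) : IsNormalMap (fun a => φ (ψ a)) := by
  obtain ⟨⟨φ', rfl⟩, h1⟩ := hφ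
  obtain ⟨⟨ψ', rfl⟩, h2⟩ := hψ
  exact ⟨⟨φ' ∘L ψ', rfl⟩, fun ω hω => h2 _ (h1 ω hω)⟩

variable [CompleteSpace H] {d : ℕ} {X : WeightSeq d} {T L : Fin d → H →L[ℂ] H}

/-- Supplies the square summable families that represent ω ∘ Φ in the proof of normality. -/
theorem hasSum_sq_wordCol (hX : ∀ k, 1 ≤ k → (X k).PosSemidef)
    {C : ∀ k : ℕ, Matrix (Fin k → Fin d) (Fin k → Fin d) ℂ}
    (hC : ∀ k, 1 ≤ k → X k = (C k).conjTranspose * C k) (hT : PhiSummable X T) (g : H) :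
    HasSum (fun s : Σ j : ℕ, Fin (j + 1) → Fin d => ‖wordCol (C (s.1 + 1)) T g s.2‖ ^ 2)
      (RCLike.re ⟪g, Phi X T T 1 g⟫_ℂ) := by
  have h1 (j : ℕ) : ∑ γ, ‖wordCol (C (j + 1)) T g γ‖ ^ 2 =
      RCLike.re ⟪g, rowTerm X T T 1 (j + 1) g⟫_ℂ := by
    simp [inner_rowTerm (hC (j + 1) (by simp)), ← Complex.ofReal_pow]
  have h2 := (phi_hasSum hX hT hT 1).re_hasSum g g
  have h3 : Summable fun s : Σ j : ℕ, Fin (j + 1) → Fin d =>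
      ‖wordCol (C (s.1 + 1)) T g s.2‖ ^ 2 := by
    refine (summable_sigma_of_nonneg fun s => by positivity).2
      ⟨fun j => (hasSum_fintype _).summable, ?_⟩
    simp only [tsum_fintype, h1]
    exact h2.summable
  have h4 := h3.hasSum.sigma fun j => hasSum_fintype _
  simp only [h1] at h4
  exact h4.unique h2 ▸ h3.hasSum

/-- Inserting `inner_rowTerm` into ω = ∑ ⟨x_n, · y_n⟩ gives a sum of the same shape, indexed by n,
the word length and the middle index. -/
theorem isNormalMap_sub_phi (hX : ∀ k, 1 ≤ k → (X k).PosSemidef) (hT : PhiSummable X T)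
    (hL : PhiSummable X L) : IsNormalMap (fun a => a - Phi X T L a) := by
  refine ⟨⟨1 - phiCLM hX hT hL, rfl⟩, fun ω hω => ?_⟩
  suffices h : IsNormalFunctional (fun a => ω (Phi X T L a)) by
    have h2 : ω ∘ (fun a => a - Phi X T L a) = fun a => ω a - ω (Phi X T L a) :=
      funext fun a => hω.map_sub _ _
    rw [h2]
    exact hω.sub h
  obtain ⟨x, y, hx, hy, hω⟩ := hω
  have hC' (k : ℕ) : ∃ C : Matrix (Fin k → Fin d) (Fin k → Fin d) ℂ,
      1 ≤ k → X k = C.conjTranspose * C := by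
    by_cases hk : 1 ≤ k
    · obtain ⟨C, hC⟩ := exists_eq_conjTranspose_mul_self (hX k hk)
      exact ⟨C, fun _ => hC⟩
    · exact ⟨0, fun h => absurd h hk⟩
  choose C hC using hC'
  have hsq {T : Fin d → H →L[ℂ] H} (hT : PhiSummable X T) {x : ℕ → H}
      (hx : Summable fun n => ‖x n‖ ^ 2) :
      Summable fun p : ℕ × (Σ j : ℕ, Fin (j + 1) → Fin d) =>
        ‖wordCol (C (p.2.1 + 1)) T (x p.1) p.2.2‖ ^ 2 := by
    have h1 (n : ℕ) := hasSum_sq_wordCol hX hC hT (x n)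
    refine (summable_prod_of_nonneg fun p => by positivity).2 ⟨fun n => (h1 n).summable, ?_⟩
    simp only [fun n => (h1 n).tsum_eq]
    refine Summable.of_nonneg_of_le (fun n => ?_) (fun n => re_inner_le_norm_mul _ _)
      (hx.mul_left _)
    exact (phi_isPositive hX hT ContinuousLinearMap.isPositive_one).re_inner_nonneg_right _
  refine isNormalFunctional_of_countable (hsq hT hx) (hsq hL hy) fun a => ?_
  have hs := summable_inner_of_summable_sq (hsq hT hx) (hsq hL hy) a
  rw [hs.tsum_prod, hω]
  refine tsum_congr fun n => ?_
  have hsn := hs.prod_factor n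
  rw [hsn.tsum_sigma, ← (phi_hasSum hX hT hL a (x n) (y n)).tsum_eq]
  exact tsum_congr fun j => by rw [tsum_fintype, inner_rowTerm (hC (j + 1) (by simp))]

end Normal

/-! ### A criterion for completely positive kernels -/

section Criterion

variable {H : Type u} [NormedAddCommGroup H] [InnerProductSpace ℂ H] [CompleteSpace H]

/-- A matrix of operators with a positive quadratic form is of the form `N^* N`. -/
theorem exists_eq_sum_star_mul {n : Type*} [Fintype n] {M : n → n → H →L[ℂ] H}
    (hM : ∀ h : n → H, 0 ≤ ∑ i, ∑ j, ⟪h i, M i j (h j)⟫_ℂ) :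
    ∃ N : n → n → H →L[ℂ] H, ∀ i j, M i j = ∑ k, star (N k i) * N k j := by
  classical
  let pr (i : n) : PiLp 2 (fun _ : n => H) →L[ℂ] H := PiLp.proj 2 (fun _ : n => H) i
  -- M becomes one positive operator on the Hilbert sum; writing it as s*s, the blocks of s are the
  -- entries of N.
  let Q : PiLp 2 (fun _ : n => H) →L[ℂ] PiLp 2 (fun _ : n => H) :=
    ∑ i, ∑ j, ContinuousLinearMap.adjoint (pr i) ∘L M i j ∘L pr j
  have hQ (v w : PiLp 2 (fun _ : n => H)) :
      ⟪v, Q w⟫_ℂ = ∑ i, ∑ j, ⟪v i, M i j (w j)⟫_ℂ := by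
    simp [Q, pr, sum_apply, ContinuousLinearMap.adjoint_inner_right]
  have hpos : Q.IsPositive := isPositive_of_inner_nonneg fun v => by rw [hQ]; exact hM _
  obtain ⟨s, hs⟩ := IsPositive.exists_inner_eq hpos
  have hsingle (i k : n) (g : H) :
      ContinuousLinearMap.adjoint (pr i) g k = if k = i then g else 0 := by
    refine ext_inner_right ℂ fun x => ?_
    have h1 : ⟪ContinuousLinearMap.adjoint (pr i) g, PiLp.single 2 k x⟫_ℂ =
        ⟪g, (PiLp.single 2 k x : PiLp 2 (fun _ : n => H)) i⟫_ℂ :=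
      ContinuousLinearMap.adjoint_inner_left _ _ _
    rw [PiLp.inner_apply, Finset.sum_eq_single k
      (fun j _ hj => by simp [hj]) (by simp)] at h1
    rw [PiLp.single_eq_same] at h1
    rw [h1]
    by_cases h : k = i
    · subst h; simp
    · simp [h, Ne.symm h]
  refine ⟨fun k j => pr k ∘L s ∘L ContinuousLinearMap.adjoint (pr j), fun i j => ?_⟩
  refine ContinuousLinearMap.ext fun h => ext_inner_left ℂ fun g => ?_
  have h1 : ⟪g, M i j h⟫_ℂ = ⟪ContinuousLinearMap.adjoint (pr i) g,
      Q (ContinuousLinearMap.adjoint (pr j) h)⟫_ℂ := by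
    rw [hQ, Finset.sum_eq_single i, Finset.sum_eq_single j] <;> simp +contextual [hsingle]
  rw [h1, hs]
  simp only [mul_apply_eq_comp, sum_apply, inner_sum, ContinuousLinearMap.star_eq_adjoint,
    ContinuousLinearMap.adjoint_inner_right]
  rw [PiLp.inner_apply]
  rfl

variable {S : Type v}

theorem cstarMatrix_sum_apply {ι n A : Type*} [AddCommMonoid A] (s : Finset ι)
    (M : ι → CStarMatrix n n A) (i j : n) : (∑ r ∈ s, M r) i j = ∑ r ∈ s, M r i j := by
  induction s using Finset.cons_induction with
  | empty => rfl
  | cons a s ha ih => rw [Finset.sum_cons, Finset.sum_cons, ← ih]; rfl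

/-- A map-valued kernel with normal values is completely positive if all the operator matrices
`(F(V_i,V_j)(b_i b_j^*))` are positive. -/
theorem isCPKernel_of_nonneg {F : S → S → (H →L[ℂ] H) → (H →L[ℂ] H)}
    (hn : ∀ z w, IsNormalMap (F z w))
    (hF : ∀ (n : ℕ) (p : Fin n → S × (H →L[ℂ] H)) (h : Fin n → H),
      0 ≤ ∑ i, ∑ j, ⟪h i, F (p i).1 (p j).1 ((p i).2 * star (p j).2) (h j)⟫_ℂ) :
    IsCPKernel F := by
  refine ⟨hn, fun n V => ?_⟩
  have hF' {ι : Type} [Fintype ι] (p : ι → S × (H →L[ℂ] H)) (h : ι → H) :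
      0 ≤ ∑ i, ∑ j, ⟪h i, F (p i).1 (p j).1 ((p i).2 * star (p j).2) (h j)⟫_ℂ := by
    let e := Fintype.equivFin ι
    rw [← e.symm.sum_comp]
    simp_rw [← e.symm.sum_comp (fun j => ⟪h _, F (p _).1 (p j).1 ((p _).2 * star (p j).2) (h j)⟫_ℂ)]
    exact hF _ (p ∘ e.symm) (h ∘ e.symm)
  choose F' hF'eq using fun z w => (hn z w).1
  let Ψ : CStarMatrix (Fin n) (Fin n) (H →L[ℂ] H) →ₗ[ℂ] CStarMatrix (Fin n) (Fin n) (H →L[ℂ] H) :=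
    { toFun := fun M => CStarMatrix.ofMatrix (Matrix.of fun i j => F (V i) (V j) (M i j))
      map_add' := fun M N => CStarMatrix.ext fun i j => by
        simp [← hF'eq]
      map_smul' := fun c M => CStarMatrix.ext fun i j => by
        simp [← hF'eq] }
  refine ⟨⟨Ψ, fun k M hM => ?_⟩, fun M i j => rfl⟩
  rw [StarOrderedRing.nonneg_iff] at hM
  induction hM using AddSubmonoid.closure_induction with
  | zero => exact le_of_eq (CStarMatrix.ext fun p q => by simp)
  | add M M' _ _ h₁ h₂ =>
    refine (add_nonneg h₁ h₂).trans_eq (CStarMatrix.ext fun p q => ?_)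
    simp
  | mem M hM =>
  obtain ⟨N, rfl⟩ := hM
  -- The entries of N*N are sums over r of b_i b_j* with b_i = N_{r,i}*, so the amplified form is a
  -- sum of forms covered by the hypothesis.
  have hpos (h : Fin k × Fin n → H) : 0 ≤ ∑ i : Fin k × Fin n, ∑ j : Fin k × Fin n,
      ⟪h i, F (V i.2) (V j.2) ((star N * N) i.1 j.1 i.2 j.2) (h j)⟫_ℂ := by
    have e (i j : Fin k × Fin n) : ⟪h i, F (V i.2) (V j.2) ((star N * N) i.1 j.1 i.2 j.2) (h j)⟫_ℂ =
        ∑ r : Fin k × Fin n, ⟪h i, F (V i.2) (V j.2)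
          (star (N r.1 i.1 r.2 i.2) * star (star (N r.1 j.1 r.2 j.2))) (h j)⟫_ℂ := by
      simp only [CStarMatrix.mul_apply, CStarMatrix.star_apply, star_star, ← hF'eq,
        Fintype.sum_prod_type, map_sum, sum_apply, inner_sum, cstarMatrix_sum_apply]
    simp only [e]
    have e2 : ∑ i : Fin k × Fin n, ∑ j : Fin k × Fin n, ∑ r : Fin k × Fin n,
        ⟪h i, F (V i.2) (V j.2)
          (star (N r.1 i.1 r.2 i.2) * star (star (N r.1 j.1 r.2 j.2))) (h j)⟫_ℂ =
        ∑ r : Fin k × Fin n, ∑ i : Fin k × Fin n, ∑ j : Fin k × Fin n, ⟪h i, F (V i.2) (V j.2)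
          (star (N r.1 i.1 r.2 i.2) * star (star (N r.1 j.1 r.2 j.2))) (h j)⟫_ℂ := by
      rw [Finset.sum_comm]
      conv_lhs => enter [2, i]; rw [Finset.sum_comm]
      rw [Finset.sum_comm]
      exact Finset.sum_congr rfl fun r _ => Finset.sum_comm
    rw [e2]
    exact Finset.sum_nonneg fun r _ =>
      hF' (fun i : Fin k × Fin n => (V i.2, star (N r.1 i.1 r.2 i.2))) h
  -- Positivity in the nested matrix algebra is obtained by exhibiting the image as R'*R',
  -- regrouping the entries of R.
  obtain ⟨R, hR⟩ := exists_eq_sum_star_mul hpos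
  let R' : CStarMatrix (Fin k) (Fin k) (CStarMatrix (Fin n) (Fin n) (H →L[ℂ] H)) :=
    CStarMatrix.ofMatrix (Matrix.of fun p q => CStarMatrix.ofMatrix (Matrix.of fun i j =>
      R (p, i) (q, j)))
  have hR' : (star N * N).map Ψ = star R' * R' := by
    refine CStarMatrix.ext fun p q => CStarMatrix.ext fun i j => ?_
    refine (hR (p, i) (q, j)).trans ?_
    simp [R', CStarMatrix.mul_apply, cstarMatrix_sum_apply, CStarMatrix.star_apply,
      Fintype.sum_prod_type]
  rw [hR']
  exact star_mul_self_nonneg R'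

end Criterion

/-! ### Hilbert space models of a completely positive kernel on `D_c(X,H)` -/

section Model

variable {H : Type u} [NormedAddCommGroup H] [InnerProductSpace ℂ H] [CompleteSpace H]
  {F : Type v} [NormedAddCommGroup F] [InnerProductSpace ℂ F] [CompleteSpace F]
  {d : ℕ} {X : WeightSeq d} {K : CPKernel H (Dc H X)}

/-- Operators `E (z,b) : H → F` with `E (z,b)^* E (w,a) = K(z,w)(b a^*)`. -/
def IsModel (K : CPKernel H (Dc H X)) (E : Dc H X × (H →L[ℂ] H) → H →L[ℂ] F) : Prop :=
  ∀ p q, ContinuousLinearMap.adjoint (E p) ∘L E q = K p.1 q.1 (p.2 * star q.2)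

/-- The ranges of the operators `E p` span a dense subspace. -/
def IsTotal (E : Dc H X × (H →L[ℂ] H) → H →L[ℂ] F) : Prop :=
  ∀ u : F, (∀ p h, ⟪E p h, u⟫_ℂ = 0) → u = 0

/-- `M_i^* E (z,b) = E (z,b) z_i^*`. -/
def Intertwines (E : Dc H X × (H →L[ℂ] H) → H →L[ℂ] F) (M : Fin d → F →L[ℂ] F) : Prop :=
  ∀ i p h, ContinuousLinearMap.adjoint (M i) (E p h) = E p (star (p.1.1 i) h)

variable {E : Dc H X × (H →L[ℂ] H) → H →L[ℂ] F} {M : Fin d → F →L[ℂ] F}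

theorem Intertwines.adjoint_comp (hM : Intertwines E M) (p : Dc H X × (H →L[ℂ] H)) (i : Fin d) :
    ContinuousLinearMap.adjoint (E p) ∘L M i = p.1.1 i ∘L ContinuousLinearMap.adjoint (E p) := by
  refine ContinuousLinearMap.ext fun x => ext_inner_left ℂ fun h => ?_
  simp only [ContinuousLinearMap.comp_apply, ContinuousLinearMap.adjoint_inner_right]
  rw [← ContinuousLinearMap.adjoint_inner_left, hM, ← ContinuousLinearMap.adjoint_inner_left,
    ContinuousLinearMap.star_eq_adjoint, ContinuousLinearMap.adjoint_inner_right]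

theorem IsTotal.clm_ext (hE : IsTotal E) {A B : F →L[ℂ] F} (h : ∀ p x, A (E p x) = B (E p x)) :
    A = B := by
  refine ContinuousLinearMap.ext fun y => ext_inner_right ℂ fun u => ?_
  rw [← ContinuousLinearMap.adjoint_inner_right, ← ContinuousLinearMap.adjoint_inner_right]
  congr 1
  rw [← sub_eq_zero]
  refine hE _ fun p x => ?_
  rw [inner_sub_right, ContinuousLinearMap.adjoint_inner_right,
    ContinuousLinearMap.adjoint_inner_right, h, sub_self]

/-- The map `(h_p)_p ↦ ∑ E_p h_p`. -/
def synthesis (E : Dc H X × (H →L[ℂ] H) → H →L[ℂ] F) :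
    (Dc H X × (H →L[ℂ] H) →₀ H) →ₗ[ℂ] F :=
  Finsupp.lsum ℂ fun p => (E p : H →ₗ[ℂ] F)

omit [CompleteSpace F] in
theorem synthesis_apply (E : Dc H X × (H →L[ℂ] H) → H →L[ℂ] F)
    (vv : Dc H X × (H →L[ℂ] H) →₀ H) : synthesis E vv = ∑ p ∈ vv.support, E p (vv p) := rfl

omit [CompleteSpace F] in
theorem synthesis_single (E : Dc H X × (H →L[ℂ] H) → H →L[ℂ] F)
    (p : Dc H X × (H →L[ℂ] H)) (h : H) : synthesis E (Finsupp.single p h) = E p h := by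
  simp [synthesis]

theorem IsTotal.denseRange (hE : IsTotal E) : DenseRange (synthesis E) := by
  have h1 : (LinearMap.range (synthesis E)).topologicalClosure = ⊤ := by
    rw [Submodule.topologicalClosure_eq_top_iff, Submodule.eq_bot_iff]
    refine fun u hu => hE u fun p h => ?_
    exact (Submodule.mem_orthogonal _ _).1 hu _ ⟨_, synthesis_single E p h⟩
  rw [Submodule.dense_iff_topologicalClosure_eq_top.symm] at h1
  rwa [LinearMap.coe_range] at h1

theorem Intertwines.compress_phi (hX : ∀ k, 1 ≤ k → (X k).PosSemidef)
    (hM : Intertwines E M) (hMs : PhiSummable X M) (a : F →L[ℂ] F)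
    (p q : Dc H X × (H →L[ℂ] H)) :
    ContinuousLinearMap.adjoint (E p) ∘L Phi X M M a ∘L E q =
      Phi X p.1.1 q.1.1 (ContinuousLinearMap.adjoint (E p) ∘L a ∘L E q) :=
  adjoint_comp_phi_comp (hM.adjoint_comp p) (hM.adjoint_comp q) hX hMs a

theorem isNormalMap_sub_phi_comp (hX : ∀ k, 1 ≤ k → (X k).PosSemidef) (K : CPKernel H (Dc H X))
    (T L : Dc H X) : IsNormalMap (fun a => K T L a - Phi X T.1 L.1 (K T L a)) :=
  (isNormalMap_sub_phi hX T.2.2.1 L.2.2.1).comp (K.isCPKernel.normal T L)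

/-- If the model carries a contractive intertwining tuple, then `(id - Φ) ∘ K` is completely
positive. -/
theorem Intertwines.isCPKernel (hX : ∀ k, 1 ≤ k → (X k).PosSemidef) (hE : IsModel K E)
    (hM : Intertwines E M) (hMs : PhiSummable X M) (hM1 : ‖Phi X M M 1‖ ≤ 1) :
    IsCPKernel fun (T L : Dc H X) a => K T L a - Phi X T.1 L.1 (K T L a) := by
  refine isCPKernel_of_nonneg (isNormalMap_sub_phi_comp hX K) fun n p h => ?_
  -- Compressing the identity: the kernel matrix is the Gram matrix of the vectors E_{p_i} h_i for
  -- the form of 1 - Φ_M(I).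
  have key (i j : Fin n) : ⟪h i, (K (p i).1 (p j).1 ((p i).2 * star (p j).2) -
      Phi X (p i).1.1 (p j).1.1 (K (p i).1 (p j).1 ((p i).2 * star (p j).2))) (h j)⟫_ℂ =
      ⟪E (p i) (h i), E (p j) (h j) - Phi X M M 1 (E (p j) (h j))⟫_ℂ := by
    have h1 := hM.compress_phi hX hMs 1 (p i) (p j)
    have h2 : ContinuousLinearMap.adjoint (E (p i)) ∘L 1 ∘L E (p j) =
      ContinuousLinearMap.adjoint (E (p i)) ∘L E (p j) := rfl
    rw [h2] at h1
    rw [← hE (p i) (p j), ← h1]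
    simp [ContinuousLinearMap.adjoint_inner_right]
  simp only [key]
  have h3 : ∑ i, ∑ j, ⟪E (p i) (h i), E (p j) (h j) - Phi X M M 1 (E (p j) (h j))⟫_ℂ =
      ⟪∑ i, E (p i) (h i), (1 - Phi X M M 1) (∑ i, E (p i) (h i))⟫_ℂ := by
    rw [map_sum, sum_inner]
    refine Finset.sum_congr rfl fun i _ => ?_
    rw [inner_sum]
    rfl
  rw [h3]
  generalize ∑ i, E (p i) (h i) = x
  have h4 := phi_isPositive hX hMs ContinuousLinearMap.isPositive_one
  have h5 := re_inner_le_norm_mul (Phi X M M 1) x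
  rw [sub_apply, inner_sub_right, inner_eq_ofReal_re h4, one_apply_eq_self,
    inner_self_eq_norm_sq_to_K, sub_nonneg, RCLike.ofReal_eq_complex_ofReal,
    ← Complex.ofReal_pow, Complex.real_le_real]
  have h6 : RCLike.re ⟪x, Phi X M M 1 x⟫_ℂ ≤ ‖x‖ ^ 2 := by nlinarith [sq_nonneg ‖x‖]
  exact h6

/-! ### Consequences of complete positivity of (id - Φ) ∘ K -/

section Positive

variable (hX : ∀ k, 1 ≤ k → (X k).PosSemidef) (hE : IsModel K E)
  (hcp : IsCPKernel fun (T L : Dc H X) a => K T L a - Phi X T.1 L.1 (K T L a))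
include hX hE hcp

-- This is the inequality Φ_M(I) ≤ I on the span of the ranges, stated through the kernel because M
-- is yet to be constructed.
omit hX in
theorem re_sum_phi_le (t : Finset (Dc H X × (H →L[ℂ] H))) (h : Dc H X × (H →L[ℂ] H) → H) :
    RCLike.re (∑ p ∈ t, ∑ q ∈ t, ⟪h p, Phi X p.1.1 q.1.1
      (ContinuousLinearMap.adjoint (E p) ∘L E q) (h q)⟫_ℂ) ≤ ‖∑ p ∈ t, E p (h p)‖ ^ 2 := by
  let e := t.equivFin
  have e2 {A : Type} [AddCommMonoid A] (g : Dc H X × (H →L[ℂ] H) → A) :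
      ∑ x ∈ t, g x = ∑ i, g (e.symm i) := by
    rw [← Finset.sum_coe_sort, ← e.symm.sum_comp]
  have h1 := (cstarMatrix_nonneg (hcp.matrix_nonneg fun i => (e.symm i).1)).2 fun i => h (e.symm i)
  have h2 : 0 ≤ RCLike.re (∑ p ∈ t, ∑ q ∈ t, ⟪(ContinuousLinearMap.adjoint (E p) ∘L E q -
      Phi X p.1.1 q.1.1 (ContinuousLinearMap.adjoint (E p) ∘L E q)) (h q), h p⟫_ℂ) := by
    simp only [e2, hE _ _]
    exact h1
  have h3 : ‖∑ p ∈ t, E p (h p)‖ ^ 2 = RCLike.re (∑ p ∈ t, ∑ q ∈ t, ⟪h p,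
      (ContinuousLinearMap.adjoint (E p) ∘L E q) (h q)⟫_ℂ) := by
    rw [← inner_self_eq_norm_sq (𝕜 := ℂ), sum_inner]
    simp [inner_sum, ContinuousLinearMap.adjoint_inner_right]
  rw [h3, ← sub_nonneg, ← map_sub, ← Finset.sum_sub_distrib]
  refine h2.trans_eq ?_
  simp only [← Finset.sum_sub_distrib, map_sum]
  refine Finset.sum_congr rfl fun p _ => Finset.sum_congr rfl fun q _ => ?_
  rw [← inner_sub_right, ← sub_apply, inner_re_symm]

-- Each length contributes a sum of squares, so any part of the series is bounded by the whole.
omit hX hE hcp in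
theorem re_sum_rowTerm_eq {k : ℕ} {C : Matrix (Fin k → Fin d) (Fin k → Fin d) ℂ}
    (hC : X k = C.conjTranspose * C)
    (t : Finset (Dc H X × (H →L[ℂ] H))) (h : Dc H X × (H →L[ℂ] H) → H) :
    RCLike.re (∑ p ∈ t, ∑ q ∈ t, ⟪h p, rowTerm X p.1.1 q.1.1
      (ContinuousLinearMap.adjoint (E p) ∘L E q) k (h q)⟫_ℂ) =
      ∑ γ, ‖∑ p ∈ t, E p (wordCol C p.1.1 (h p) γ)‖ ^ 2 := by
  have h1 (γ : Fin k → Fin d) : ‖∑ p ∈ t, E p (wordCol C p.1.1 (h p) γ)‖ ^ 2 =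
      RCLike.re (∑ p ∈ t, ∑ q ∈ t, ⟪wordCol C p.1.1 (h p) γ,
        (ContinuousLinearMap.adjoint (E p) ∘L E q) (wordCol C q.1.1 (h q) γ)⟫_ℂ) := by
    rw [← inner_self_eq_norm_sq (𝕜 := ℂ), sum_inner]
    simp [inner_sum, ContinuousLinearMap.adjoint_inner_right]
  simp only [h1, inner_rowTerm hC, ← map_sum]
  congr 1
  symm
  rw [Finset.sum_comm]
  exact Finset.sum_congr rfl fun p _ => Finset.sum_comm

theorem sum_re_sum_rowTerm_le (s : Finset ℕ) (t : Finset (Dc H X × (H →L[ℂ] H)))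
    (h : Dc H X × (H →L[ℂ] H) → H) :
    ∑ k ∈ s, RCLike.re (∑ p ∈ t, ∑ q ∈ t, ⟪h p, rowTerm X p.1.1 q.1.1
      (ContinuousLinearMap.adjoint (E p) ∘L E q) (k + 1) (h q)⟫_ℂ) ≤ ‖∑ p ∈ t, E p (h p)‖ ^ 2 := by
  refine le_trans ?_ (re_sum_phi_le hE hcp t h)
  refine sum_le_hasSum s (fun k _ => ?_) (Complex.hasSum_re (hasSum_sum fun p _ =>
    hasSum_sum fun q _ => phi_hasSum hX p.1.2.2.1 q.1.2.2.1 _ _ _))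
  obtain ⟨C, hC⟩ := exists_eq_conjTranspose_mul_self (hX (k + 1) (by simp))
  refine (?_ : (0 : ℝ) ≤ _).trans_eq (re_sum_rowTerm_eq hC t h).symm
  positivity

/-- The operators `E_p h ↦ E_p z_i^* h` are bounded, because `X_1` is invertible. -/
theorem exists_norm_sum_le (hX1 : IsUnit (X 1)) (i : Fin d) :
    ∃ B : ℝ, ∀ (t : Finset (Dc H X × (H →L[ℂ] H))) (h : Dc H X × (H →L[ℂ] H) → H),
      ‖∑ p ∈ t, E p (star (p.1.1 i) (h p))‖ ≤ B * ‖∑ p ∈ t, E p (h p)‖ := by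
  obtain ⟨C, hC⟩ := exists_eq_conjTranspose_mul_self (hX 1 le_rfl)
  have hCu : IsUnit C.det := by
    rw [hC, Matrix.isUnit_iff_isUnit_det, Matrix.det_mul] at hX1
    exact isUnit_of_mul_isUnit_right hX1
  have hDC : C⁻¹ * C = 1 := Matrix.nonsing_inv_mul C hCu
  let α : Fin 1 → Fin d := fun _ => i
  -- Since C is invertible, z_i* g is a combination of the column C z* g, with coefficients from row
  -- i of C⁻¹.
  refine ⟨∑ γ, ‖C⁻¹ α γ‖, fun t h => ?_⟩
  have h1 (T : Fin d → H →L[ℂ] H) (g : H) : star (T i) g = ∑ γ, C⁻¹ α γ • wordCol C T g γ := by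
    simp only [wordCol, Finset.smul_sum, smul_smul]
    rw [Finset.sum_comm]
    simp only [← Finset.sum_smul, ← Matrix.mul_apply, hDC, Matrix.one_apply, ite_smul, one_smul,
      zero_smul, Finset.sum_ite_eq, Finset.mem_univ, if_true]
    simp [wordProd, α]
  have h2 (γ : Fin 1 → Fin d) :
      ‖∑ p ∈ t, E p (wordCol C p.1.1 (h p) γ)‖ ≤ ‖∑ p ∈ t, E p (h p)‖ := by
    refine le_of_sq_le_sq ?_ (norm_nonneg _)
    -- The index 0 is word length 1 after the shift.
    have h3 := sum_re_sum_rowTerm_le hX hE hcp {0} t h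
    rw [Finset.sum_singleton] at h3
    refine le_trans ?_ h3
    refine le_trans ?_ (re_sum_rowTerm_eq hC t h).ge
    exact Finset.single_le_sum (f := fun γ => ‖∑ p ∈ t, E p (wordCol C p.1.1 (h p) γ)‖ ^ 2)
      (fun _ _ => by positivity) (Finset.mem_univ γ)
  have h4 : ∑ p ∈ t, E p (star (p.1.1 i) (h p)) =
      ∑ γ, C⁻¹ α γ • ∑ p ∈ t, E p (wordCol C p.1.1 (h p) γ) := by
    simp only [h1, map_sum, map_smul, Finset.smul_sum]
    exact Finset.sum_comm
  rw [h4, Finset.sum_mul]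
  refine (norm_sum_le _ _).trans (Finset.sum_le_sum fun γ _ => ?_)
  rw [norm_smul]
  gcongr
  exact h2 γ

/-- The norm bound gives both well-definedness on the dense span and extension to F. The extended
operator is M_i*. -/
theorem exists_intertwines (hX1 : IsUnit (X 1)) (ht : IsTotal E) :
    ∃ M : Fin d → F →L[ℂ] F, Intertwines E M := by
  have key (i : Fin d) : ∃ A : F →L[ℂ] F, ∀ p h, A (E p h) = E p (star (p.1.1 i) h) := by
    obtain ⟨B, hB⟩ := exists_norm_sum_le hX hE hcp hX1 i
    let φ : (Dc H X × (H →L[ℂ] H) →₀ H) →ₗ[ℂ] F := synthesis fun p => E p ∘L star (p.1.1 i)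
    refine ⟨φ.extendOfNorm (synthesis E), fun p h => ?_⟩
    have h1 := LinearMap.extendOfNorm_eq (f := φ) ht.denseRange
      ⟨B, fun vv => hB vv.support vv⟩ (Finsupp.single p h)
    rw [synthesis_single] at h1
    rw [h1]
    exact synthesis_single _ p h
  choose A hA using key
  exact ⟨fun i => ContinuousLinearMap.adjoint (A i), fun i p h => by
    rw [ContinuousLinearMap.adjoint_adjoint, hA]⟩

/-- On the dense span, compression turns the left side into kernel sums; both sides are continuous
in v. -/
theorem Intertwines.sum_re_rowTerm_le (ht : IsTotal E) (hM : Intertwines E M) (s : Finset ℕ)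
    (v : F) : ∑ k ∈ s, RCLike.re ⟪v, rowTerm X M M 1 (k + 1) v⟫_ℂ ≤ 1 * ‖v‖ ^ 2 := by
  refine ht.denseRange.induction_on v (isClosed_le (by fun_prop) (by fun_prop)) fun vv => ?_
  rw [synthesis_apply, one_mul]
  refine (sum_re_sum_rowTerm_le hX hE hcp s vv.support vv).trans_eq' ?_
  refine Finset.sum_congr rfl fun k _ => ?_
  congr 1
  rw [map_sum, sum_inner]
  refine Finset.sum_congr rfl fun p _ => ?_
  rw [inner_sum]
  refine Finset.sum_congr rfl fun q _ => ?_
  have h1 := adjoint_comp_rowTerm_comp (hM.adjoint_comp p) (hM.adjoint_comp q) X 1 (k + 1)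
  have h2 : ContinuousLinearMap.adjoint (E p) ∘L 1 ∘L E q =
    ContinuousLinearMap.adjoint (E p) ∘L E q := rfl
  rw [h2] at h1
  rw [← h1]
  simp [ContinuousLinearMap.adjoint_inner_right]

omit hcp in
theorem Intertwines.compress_phi_iterate (hM : Intertwines E M) (hMs : PhiSummable X M)
    (p : Dc H X × (H →L[ℂ] H)) (m : ℕ) :
    ContinuousLinearMap.adjoint (E p) ∘L (Phi X M M)^[m] 1 ∘L E p =
      (Phi X p.1.1 p.1.1)^[m] (K p.1 p.1 (p.2 * star p.2)) := by
  induction m with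
  | zero => exact hE p p
  | succ m ih => rw [Function.iterate_succ_apply', Function.iterate_succ_apply', ← ih,
      hM.compress_phi hX hMs]

-- For 0 ≤ Q ≤ 1 one has Q² ≤ Q. This upgrades convergence of quadratic forms to strong convergence.
omit hX hE hcp in
theorem norm_sq_apply_le {Q : F →L[ℂ] F} (hQ : Q.IsPositive) (hQ1 : Q ≤ 1) (x : F) :
    ‖Q x‖ ^ 2 ≤ RCLike.re ⟪x, Q x⟫_ℂ := by
  have h1 (y : F) : RCLike.re ⟪y, Q y⟫_ℂ ≤ ‖y‖ ^ 2 := by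
    have := (show (1 - Q).IsPositive from hQ1).re_inner_nonneg_right y
    rw [sub_apply, inner_sub_right, map_sub, one_apply_eq_self, inner_self_eq_norm_sq] at this
    linarith
  obtain ⟨s, hs⟩ := IsPositive.exists_inner_eq hQ
  have h2 (y : F) : RCLike.re ⟪y, Q y⟫_ℂ = ‖s y‖ ^ 2 := by rw [hs, inner_self_eq_norm_sq]
  rw [h2]
  have h3 : ‖s (Q x)‖ ≤ ‖Q x‖ := by
    refine le_of_sq_le_sq ?_ (norm_nonneg _)
    rw [← h2]; exact h1 _
  have h4 : ‖Q x‖ ^ 2 ≤ ‖Q x‖ * ‖s x‖ := by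
    rw [← inner_self_eq_norm_sq (𝕜 := ℂ), hs]
    calc _ ≤ ‖⟪s (Q x), s x⟫_ℂ‖ := RCLike.re_le_norm _
      _ ≤ ‖s (Q x)‖ * ‖s x‖ := norm_inner_le_norm _ _
      _ ≤ _ := by gcongr
  nlinarith [norm_nonneg (Q x), norm_nonneg (s x)]

/-- If `(id - Φ) ∘ K` is completely positive, then an intertwining tuple on a model of `K` is pure
and belongs to the closed domain. -/
theorem Intertwines.mem_dbarCp (ht : IsTotal E) (hM : Intertwines E M) : M ∈ DbarCp F X := by
  have one_pos := ContinuousLinearMap.isPositive_one (𝕜 := ℂ) (E := F)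
  have hrow (k : ℕ) : (rowTerm X M M 1 (k + 1)).IsPositive :=
    ((dominated_zero one_pos one_pos).rowTerm (hX (k + 1) (by simp)) M M).left
  have hbound := hM.sum_re_rowTerm_le hX hE hcp ht
  obtain ⟨P, hP⟩ := exists_wotHasSum_of_isPositive hrow hbound
  have hMs : PhiSummable X M := hP.summable
  have hre (v : F) : RCLike.re ⟪v, Phi X M M 1 v⟫_ℂ ≤ 1 * ‖v‖ ^ 2 :=
    hasSum_le_of_sum_le (hMs.hasSum.re_hasSum v v) fun s => hbound s v
  have hpos : (Phi X M M 1).IsPositive := phi_isPositive hX hMs one_pos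
  have hle : Phi X M M 1 ≤ 1 := by
    refine isPositive_of_inner_nonneg fun v => ?_
    rw [sub_apply, inner_sub_right, inner_eq_ofReal_re hpos, one_apply_eq_self,
      inner_self_eq_norm_sq_to_K, sub_nonneg, RCLike.ofReal_eq_complex_ofReal,
      ← Complex.ofReal_pow, Complex.real_le_real, ← one_mul (‖v‖ ^ 2)]
    exact hre v
  have hanti : Antitone fun m : ℕ => (Phi X M M)^[m] 1 := by
    refine antitone_nat_of_succ_le fun m => ?_
    rw [Function.iterate_succ_apply]
    exact (phi_mono hX hMs).iterate m hle
  have hitpos (m : ℕ) : ((Phi X M M)^[m] 1).IsPositive := by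
    induction m with
    | zero => exact one_pos
    | succ m ih =>
      rw [Function.iterate_succ_apply']
      exact phi_isPositive hX hMs ih
  have hit1 (m : ℕ) : (Phi X M M)^[m] 1 ≤ 1 := hanti (Nat.zero_le m)
  refine ⟨fun i j => ?_, hMs, IsPositive.norm_le_of_re_inner_le hpos zero_le_one hre, hanti, ?_⟩
  -- On the total vectors E_p h the adjoints act through the coordinates of a point of the domain,
  -- which commute.
  · refine star_injective (ht.clm_ext fun p h => ?_)
    have hc : star (p.1.1 j) * star (p.1.1 i) = star (p.1.1 i) * star (p.1.1 j) := by
      rw [← star_mul, ← star_mul, p.1.2.1 i j]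
    have hc' := congrArg (fun A : H →L[ℂ] H => E p (A h)) hc
    simp only [mul_apply_eq_comp] at hc'
    rw [star_mul, star_mul]
    simp only [ContinuousLinearMap.star_eq_adjoint (M _), mul_apply_eq_comp, hM _ _ _]
    exact hc'
  -- On the range of E_p the iterates compress to Φ_z^m(κ), of norm at most c^m ‖κ‖ with c < 1.
  · have hE0 (p : Dc H X × (H →L[ℂ] H)) (h : H) :
        Filter.Tendsto (fun m : ℕ => (Phi X M M)^[m] 1 (E p h)) Filter.atTop (nhds 0) := by
      have hΦ : ‖phiCLM hX p.1.2.2.1 p.1.2.2.1‖ < 1 :=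
        norm_phiCLM_lt hX p.1.2.2.1 p.1.2.2.1 p.1.2.2.2 p.1.2.2.2
      set c := ‖phiCLM hX p.1.2.2.1 p.1.2.2.1‖
      set κ := K p.1 p.1 (p.2 * star p.2)
      have hn (m : ℕ) : ‖(Phi X p.1.1 p.1.1)^[m] κ‖ ≤ c ^ m * ‖κ‖ := by
        induction m with
        | zero => simp
        | succ m ih =>
          rw [Function.iterate_succ_apply', pow_succ', mul_assoc]
          exact ((phiCLM hX p.1.2.2.1 p.1.2.2.1).le_opNorm _).trans (by gcongr)
      have hsq (m : ℕ) : ‖(Phi X M M)^[m] 1 (E p h)‖ ^ 2 ≤ c ^ m * (‖κ‖ * ‖h‖ ^ 2) := by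
        refine (norm_sq_apply_le (hitpos m) (hit1 m) _).trans ?_
        have h1 : ⟪E p h, (Phi X M M)^[m] 1 (E p h)⟫_ℂ = ⟪h, (Phi X p.1.1 p.1.1)^[m] κ h⟫_ℂ := by
          rw [← hM.compress_phi_iterate hX hE hMs p m]
          simp [ContinuousLinearMap.adjoint_inner_right]
        rw [h1, ← mul_assoc]
        exact (re_inner_le_norm_mul _ _).trans (by gcongr; exact hn m)
      have hlim : Filter.Tendsto (fun m : ℕ => ‖(Phi X M M)^[m] 1 (E p h)‖ ^ 2) Filter.atTop
          (nhds 0) := by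
        refine squeeze_zero (fun m => by positivity) hsq ?_
        simpa using (tendsto_pow_atTop_nhds_zero_of_lt_one (norm_nonneg _) hΦ).mul_const
          (‖κ‖ * ‖h‖ ^ 2)
      rw [tendsto_zero_iff_norm_tendsto_zero]
      simpa [Real.sqrt_sq] using hlim.sqrt
    intro v
    rw [Metric.tendsto_atTop]
    intro ε hε
    obtain ⟨vv, hvv⟩ := ht.denseRange.exists_dist_lt v (half_pos hε)
    have h1 : Filter.Tendsto (fun m : ℕ => (Phi X M M)^[m] 1 (synthesis E vv)) Filter.atTop
        (nhds 0) := by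
      simp only [synthesis_apply, map_sum]
      simpa using tendsto_finsetSum vv.support fun p _ => hE0 p (vv p)
    obtain ⟨N, hN⟩ := Metric.tendsto_atTop.1 h1 _ (half_pos hε)
    refine ⟨N, fun m hm => ?_⟩
    -- The iterates lie between 0 and 1, hence are contractions, and convergence extends from the
    -- dense span.
    have h2 : ‖(Phi X M M)^[m] 1 (v - synthesis E vv)‖ ≤ ‖v - synthesis E vv‖ := by
      refine le_of_sq_le_sq ((norm_sq_apply_le (hitpos m) (hit1 m) _).trans ?_) (norm_nonneg _)
      have h3 := (show (1 - (Phi X M M)^[m] 1).IsPositive from hit1 m).re_inner_nonneg_right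
        (v - synthesis E vv)
      rw [sub_apply, inner_sub_right, map_sub, one_apply_eq_self, inner_self_eq_norm_sq] at h3
      linarith
    have h4 := hN m hm
    rw [dist_zero_right] at h4 ⊢
    rw [dist_eq_norm] at hvv
    calc ‖(Phi X M M)^[m] 1 v‖ = ‖(Phi X M M)^[m] 1 (v - synthesis E vv) +
          (Phi X M M)^[m] 1 (synthesis E vv)‖ := by rw [← map_add, sub_add_cancel]
      _ ≤ _ := norm_add_le _ _
      _ < ε / 2 + ε / 2 := add_lt_add (h2.trans_lt hvv) h4
      _ = ε := add_halves ε

end Positive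
end Model

/-! ### The two models of a kernel and the multiplication operators -/

section Correspondence

variable {H : Type u} [NormedAddCommGroup H] [InnerProductSpace ℂ H] [CompleteSpace H]
  {d : ℕ} {X : WeightSeq d} {K : CPKernel H (Dc H X)}

theorem isModel_space : IsModel K (RKHS.kerFun K.Space) := fun p q => by
  rw [← RKHS.kernel_apply, RKHS.OfKernel.kernel_ofKernel]
  rfl

theorem isTotal_space : IsTotal (RKHS.kerFun K.Space) := fun u hu =>
  RKHS.ext fun p => ext_inner_left ℂ fun h => by
    rw [← RKHS.kerFun_inner, hu, RKHS.coe_zero, Pi.zero_apply, inner_zero_right]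

/-- The operators `h ↦ k_{(b,z)} ⊗ h` into `E_K ⊗ H`. -/
def tensorModel (K : CPKernel H (Dc H X)) (p : Dc H X × (H →L[ℂ] H)) : H →L[ℂ] K.Tensor :=
  RKHS.kerFun K.Tensor (K.ker p.2 p.1)

theorem tensorModel_apply (p : Dc H X × (H →L[ℂ] H)) (h : H) :
    tensorModel K p h = CPKernel.tmul (K.ker p.2 p.1) h := rfl

theorem isModel_tensor : IsModel K (tensorModel K) := fun p q => by
  rw [tensorModel, tensorModel, ← RKHS.kernel_apply, RKHS.OfKernel.kernel_ofKernel,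
    ← CPKernel.eval_ker, ← CPKernel.inn_ker_left]
  rfl

theorem tensor_ext {u v : K.Tensor}
    (h : ∀ (f : K.Corr) (x : H), ⟪CPKernel.tmul f x, u⟫_ℂ = ⟪CPKernel.tmul f x, v⟫_ℂ) : u = v :=
  RKHS.ext fun f => ext_inner_left ℂ fun x => by
    rw [← RKHS.kerFun_inner, ← RKHS.kerFun_inner]
    exact h f x

theorem inner_tmul_apply (f g : K.Corr) (h h' : H) :
    ⟪CPKernel.tmul f h, CPKernel.tmul g h'⟫_ℂ = ⟪f h, g h'⟫_ℂ := by
  rw [CPKernel.inner_tmul, CPKernel.inn, ContinuousLinearMap.comp_apply,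
    ContinuousLinearMap.adjoint_inner_right]

theorem norm_tmul (f : K.Corr) (h : H) : ‖CPKernel.tmul f h‖ = ‖f h‖ := by
  rw [norm_eq_sqrt_re_inner (𝕜 := ℂ), norm_eq_sqrt_re_inner (𝕜 := ℂ), inner_tmul_apply]

theorem inner_tensorModel_tmul (p : Dc H X × (H →L[ℂ] H)) (f : K.Corr) (h h' : H) :
    ⟪tensorModel K p h, CPKernel.tmul f h'⟫_ℂ = ⟪h, CPKernel.eval f p.1 p.2 h'⟫_ℂ := by
  rw [tensorModel_apply, CPKernel.inner_tmul, CPKernel.inn_ker_left]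

/-- The isometry `E₀ ⊗ H → E_K ⊗ H`, `f h ↦ f ⊗ h`. -/
theorem exists_clm_eq_tmul [Nontrivial H] (K : CPKernel H (Dc H X)) :
    ∃ J : K.Space →L[ℂ] K.Tensor, ∀ (f : K.Corr) (h : H), J (f h) = CPKernel.tmul f h := by
  -- A unit vector e lets each v be written as R v e with R v of rank at most one. Inner products of
  -- f ⊗ h depend only on f h, so the choice of R does not matter.
  obtain ⟨e, he⟩ := exists_norm_eq H (zero_le_one (α := ℝ))
  obtain ⟨R, hR⟩ : ∃ R : K.Space → K.Corr, ∀ v, R v e = v :=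
    ⟨fun v => (innerSL ℂ e).smulRight v, fun v => by simp [he]⟩
  let J₀ : K.Space →ₗ[ℂ] K.Tensor :=
    { toFun := fun v => CPKernel.tmul (R v) e
      map_add' := fun v w => tensor_ext fun f x => by
        rw [inner_add_right, inner_tmul_apply, inner_tmul_apply, inner_tmul_apply, hR, hR, hR,
          inner_add_right]
      map_smul' := fun c v => tensor_ext fun f x => by
        rw [inner_smul_right, inner_tmul_apply, inner_tmul_apply, hR, hR, inner_smul_right]
        rfl }
  have hJ₀ (v : K.Space) : J₀ v = CPKernel.tmul (R v) e := rfl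
  have hJ (v : K.Space) : ‖J₀ v‖ ≤ 1 * ‖v‖ := by
    rw [hJ₀, norm_tmul, hR, one_mul]
  refine ⟨J₀.mkContinuous 1 hJ, fun f h => ?_⟩
  rw [LinearMap.mkContinuous_apply, hJ₀]
  refine tensor_ext fun g y => ?_
  rw [inner_tmul_apply, inner_tmul_apply, hR]

/-- The tensor product is generated by all f in E_K. That kernel functions suffice follows because
each f ⊗ h is in the range of the bounded map J, and they are total in `K.Space`. -/
theorem isTotal_tensor : IsTotal (tensorModel K) := fun u hu => by
  rcases subsingleton_or_nontrivial H with hH | hH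
  · exact RKHS.ext fun f => Subsingleton.elim _ _
  obtain ⟨J, hJ⟩ := exists_clm_eq_tmul K
  have h0 : ContinuousLinearMap.adjoint J u = 0 := isTotal_space _ fun p h => by
    have h1 : J (RKHS.kerFun K.Space p h) = tensorModel K p h := hJ (K.ker p.2 p.1) h
    rw [ContinuousLinearMap.adjoint_inner_right, h1, hu]
  refine tensor_ext fun f x => ?_
  rw [← hJ, ← ContinuousLinearMap.adjoint_inner_right, h0, inner_zero_right, inner_zero_right]

theorem eval_mulOp {φ : Dc H X → H →L[ℂ] H} (hφ : K.IsMultiplier φ) (f : K.Corr) (z : Dc H X)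
    (b : H →L[ℂ] H) : CPKernel.eval (CPKernel.mulOp hφ f) z b = φ z * CPKernel.eval f z b :=
  (hφ f).choose_spec z b

/-- The adjoints of the operators `M_{S_i} ⊗ I_H` act on the vectors `k_{(b,z)} ⊗ h`. -/
theorem intertwines_tensor_iff (hS : ∀ i, K.IsMultiplier (coord X i))
    (M : Fin d → K.Tensor →L[ℂ] K.Tensor) :
    Intertwines (tensorModel K) M ↔ ∀ i (f : K.Corr) (h : H),
      M i (CPKernel.tmul f h) = CPKernel.tmul (CPKernel.mulOp (hS i) f) h := by
  -- Pairing with k_{(b,z)} ⊗ h evaluates at (z,b), where S_i multiplies by z_i.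
  have key (i : Fin d) (p : Dc H X × (H →L[ℂ] H)) (h : H) (f : K.Corr) (x : H) :
      ⟪tensorModel K p (star (p.1.1 i) h), CPKernel.tmul f x⟫_ℂ =
        ⟪tensorModel K p h, CPKernel.tmul (CPKernel.mulOp (hS i) f) x⟫_ℂ := by
    rw [inner_tensorModel_tmul, inner_tensorModel_tmul, eval_mulOp,
      ContinuousLinearMap.star_eq_adjoint, ContinuousLinearMap.adjoint_inner_left]
    rfl
  constructor
  · intro hM i f x
    rw [← sub_eq_zero]
    refine isTotal_tensor _ fun p h => ?_
    rw [inner_sub_right, ← key, ← hM, ContinuousLinearMap.adjoint_inner_left, sub_self]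
  · intro hM i p h
    refine tensor_ext fun f x => ?_
    rw [ContinuousLinearMap.adjoint_inner_right, hM, ← inner_conj_symm, ← key, inner_conj_symm]

/-- Elements of E_K are operators into `K.Space`, so N_i ∘ f is again one; the reproducing property
identifies it with S_i f. -/
theorem isMultiplier_coord {N : Fin d → K.Space →L[ℂ] K.Space}
    (hN : Intertwines (RKHS.kerFun K.Space) N) (i : Fin d) : K.IsMultiplier (coord X i) := by
  refine fun f => ⟨N i ∘L f, fun z b => ?_⟩
  rw [← CPKernel.inn_ker_left, ← CPKernel.inn_ker_left]
  have h := congrArg (fun A : K.Space →L[ℂ] H => A ∘L f) (hN.adjoint_comp (z, b) i)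
  exact h

theorem xContractive_iff (hX : Admissible X) (K : CPKernel H (Dc H X)) :
    XContractive X K ↔
      IsCPKernel fun (T L : Dc H X) a => K T L a - Phi X T.1 L.1 (K T L a) := by
  constructor
  · rintro ⟨hS, M, hM, -, hMs, hM1, -⟩
    exact ((intertwines_tensor_iff hS M).2 hM).isCPKernel hX.posSemidef isModel_tensor hMs hM1
  · intro hcp
    obtain ⟨N, hN⟩ := exists_intertwines hX.posSemidef isModel_space hcp hX.isUnit isTotal_space
    obtain ⟨M, hM⟩ := exists_intertwines hX.posSemidef isModel_tensor hcp hX.isUnit isTotal_tensor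
    have hS := isMultiplier_coord hN
    exact ⟨hS, M, (intertwines_tensor_iff hS M).1 hM,
      hM.mem_dbarCp hX.posSemidef isModel_tensor hcp isTotal_tensor⟩

/-- `id - Φ_{T,L}` is the inverse of `K^R(T,L)`. -/
theorem kr_inverse (hd : 0 < d) (hX : ∀ k, 1 ≤ k → (X k).PosSemidef) (T L : Dc H X) :
    Function.LeftInverse (1 - phiCLM hX T.2.2.1 L.2.2.1 : (H →L[ℂ] H) →L[ℂ] H →L[ℂ] H)
        (KR X T.1 L.1) ∧
      Function.RightInverse (1 - phiCLM hX T.2.2.1 L.2.2.1 : (H →L[ℂ] H) →L[ℂ] H →L[ℂ] H)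
        (KR X T.1 L.1) := by
  have h1 : Function.LeftInverse
      (1 - phiCLM hX T.2.2.1 L.2.2.1 : (H →L[ℂ] H) →L[ℂ] H →L[ℂ] H) (KR X T.1 L.1) :=
    fun a =>
    kr_sub_phi_kr hd hX T.2.2.1 L.2.2.1 T.2.2.2 L.2.2.2 a
  refine ⟨h1, Function.LeftInverse.rightInverse_of_injective h1 ?_⟩
  -- The Neumann series makes id - Φ injective, which turns the one-sided inverse into a two-sided
  -- one.
  exact ContinuousLinearMap.isUnit_iff_bijective.1 (isUnit_one_sub_of_norm_lt_one
    (norm_phiCLM_lt hX T.2.2.1 L.2.2.1 T.2.2.2 L.2.2.2)) |>.1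

end Correspondence

end RKCorr

end

theorem theorem5p11 {H : Type*} [NormedAddCommGroup H] [InnerProductSpace ℂ H] [CompleteSpace H]
    {d : ℕ} (hd : 0 < d) (X : RKCorr.WeightSeq d) (hX : RKCorr.Admissible X)
    (K : RKCorr.CPKernel H (RKCorr.Dc H X)) :
    -- the series defining `Φ_{T,L}(a)` and `K^R_c(T,L)(a)` converge
    (∀ (T L : RKCorr.Dc H X) (a : H →L[ℂ] H),
      RKCorr.WotSummable (fun k => RKCorr.rowTerm X T.1 L.1 a (k + 1)) ∧
      RKCorr.WotSummable (fun k => RKCorr.rowTerm (RKCorr.Rsq X) T.1 L.1 a k)) ∧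
    -- contractivity is equivalent to `(id - Φ_{T,L}) ∘ K(T,L)` being a cp kernel
    (RKCorr.XContractive X K ↔
      RKCorr.IsCPKernel fun (T L : RKCorr.Dc H X) a => K T L a - RKCorr.Phi X T.1 L.1 (K T L a)) ∧
    -- and to `J(T,L) ∘ K(T,L)` being one, with `J T L` the inverse of `K^R_c(T,L)`
    ∃ J : RKCorr.Dc H X → RKCorr.Dc H X → (H →L[ℂ] H) →L[ℂ] (H →L[ℂ] H),
      (∀ T L, Function.LeftInverse (J T L) (RKCorr.KR X T.1 L.1) ∧
        Function.RightInverse (J T L) (RKCorr.KR X T.1 L.1)) ∧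
      (RKCorr.XContractive X K ↔
        RKCorr.IsCPKernel fun (T L : RKCorr.Dc H X) a => J T L (K T L a)) :=
  ⟨fun T L a => ⟨(RKCorr.phi_hasSum hX.posSemidef T.2.2.1 L.2.2.1 a).summable,
      (RKCorr.kr_hasSum hd hX.posSemidef T.2.2.1 L.2.2.1 T.2.2.2 L.2.2.2 a).summable⟩,
    RKCorr.xContractive_iff hX K,
    -- With this J, the second kernel is definitionally the first, so the same equivalence serves
    -- twice.
    fun T L => 1 - RKCorr.phiCLM hX.posSemidef T.2.2.1 L.2.2.1,
    RKCorr.kr_inverse hd hX.posSemidef, RKCorr.xContractive_iff hX K⟩
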